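/- **Setting.** Let $L$ be a first-order signature and $Th$ an $L$-theory; $\models\chi$ means that $\chi$ holds in all models of $Th$ under all assignments. A program $\mathcal A$ has $N$ procedures, one of them the main procedure $M$. A procedure $P$ has finite lists of input and output variables (together: its formals $\vec x_P$), finitely many local variables $\vec\ell_P$, and a body $\beta_P$, a quantifier-free formula over $\vec x_P,\vec\ell_P$ in $L$ extended by predicate symbols $\Sigma_Q$ (one for each procedure $Q$, applied to terms), in which the $\Sigma_Q$ occur only positively. The paths of $P$ are the propositional prime implicants of $\beta_P$, as conjunctions of literals written in the order in which their atoms first occur in $\beta_P$. Let $p$ be the maximal number of paths of a procedure and $c$ the maximal number of calls (atoms $\Sigma_Q(\vec a)$) along a path. For a model $I$ of $Th$, $[\![\cdot]\!]_I$ is the least interpretation of the $\Sigma_Q$ with $\beta_Q\Rightarrow\Sigma_Q(\vec x_Q)$ for all $Q$; $[\![P]\!]^b_I$ is the set defined by $\exists\vec\ell_P\,\beta_P$ when each $\Sigma_Q$ is read as $[\![Q]\!]^{b-1}_I$ (as $\emptyset$ if $b=0$). $\mathcal A$ satisfies $\varphi(\vec x_M)$ if $[\![M]\!]_I\subseteq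 I(\varphi)$ for all models $I$ of $Th$. A bounded assertion map $m$ assigns finitely many formulas over $\vec x_P$ to pairs $(P,b)$, non-empty for finitely many pairs only. Let $U_m^b(\Sigma_P)=\bigvee_{b'\le b}m(P,b')$, $O_m^b(\Sigma_P)=\bigwedge_{b'\ge b}m(P,b')$, and let $U_m^{-1},O_m^{-1}$ be constantly $\bot$. Write $\tau_\rho^b$, $\tau_\sigma^b$ for $\tau$ with all $\Sigma_P$ replaced according to $U_\rho^b$, $O_\sigma^b$. **BndSafety**$(\mathcal A,\varphi,n,\rho,\sigma)$ is the following nondeterministic transition system on triples $(\mathcal Q,\rho,\sigma)$, $\mathcal Q$ a set of queries $\langle P,\chi,b\rangle$ ($\chi$ a formula over $\vec x_P$, $b\in\mathbb N$), started with $\mathcal Q=\{\langle M,\neg\varphi,n\rangle\}$. The premises are decided by an oracle for satisfiability modulo $Th$. For $\langle P,\chi,b\rangle\in\mathcal Q$: * *Sum*: if $\models(\beta_P)_\sigma^{b-1}\Rightarrow\neg\chi$, choose $\psi(\vec x_P)$ with $\models(\beta_P)_\sigma^{b-1}\Rightarrow\psi$ and $\models\psi\Rightarrow\neg\chi$, remove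 from $\mathcal Q$ all $\langle P,\eta,c'\rangle$ with $c'\le b$ and $\models O_\sigma^{c'}(\Sigma_P)\wedge\psi\Rightarrow\neg\eta$, and add $\psi$ to $\sigma(P,b)$. * *Reach*: if $\pi$ is a path of $P$ with $\not\models\pi_\rho^{b-1}\Rightarrow\neg\chi$, put $\psi=\exists\vec\ell_P\,\pi_\rho^{b-1}$, remove from $\mathcal Q$ all $\langle P,\eta,c'\rangle$ with $c'\ge b$ and $\not\models\psi\Rightarrow\neg\eta$, and add $\psi$ to $\rho(P,b)$. * *Query* ($b\ge1$): if $\models(\beta_P)_\rho^{b-1}\Rightarrow\neg\chi$, and $\pi_u\wedge\Sigma_R(\vec a)\wedge\pi_v$ is a path of $P$ with $\models(\pi_u)_\sigma^{b-1}\wedge\Sigma_R(\vec a)_\rho^{b-1}\wedge(\pi_v)_\rho^{b-1}\Rightarrow\neg\chi$ and $\not\models(\pi_u)_\sigma^{b-1}\wedge\Sigma_R(\vec a)_\sigma^{b-1}\wedge(\pi_v)_\rho^{b-1}\Rightarrow\neg\chi$, put $\psi(\vec x_R)=\exists\vec y_P\,\bigl((\pi_u)_\sigma^{b-1}\wedge(\pi_v)_\rho^{b-1}\wedge\chi\wedge\vec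 x_R=\vec a\bigr)$, where $\vec y_P$ are the variables of $P$ (renamed apart from $\vec x_R$); if $\models\psi\Rightarrow\neg\eta$ for all $\langle R,\eta,b-1\rangle\in\mathcal Q$, add $\langle R,\psi,b-1\rangle$ to $\mathcal Q$. If $\mathcal Q=\emptyset$, it may return UNSAFE if $\not\models U_\rho^n(\Sigma_M)\Rightarrow\varphi$, and SAFE if $\models O_\sigma^n(\Sigma_M)\Rightarrow\varphi$ (in both cases with the current maps). **RecMC**$(\mathcal A,\varphi)$ starts with $n=0$, $\rho=\sigma=\emptyset$ and repeats: run BndSafety$(\mathcal A,\varphi,n,\rho,\sigma)$, updating $\rho,\sigma$; if the result is UNSAFE, return UNSAFE, $\rho$. Otherwise add every $\delta\in\sigma(P,n)$ with $\models(\beta_P)_\sigma^n\Rightarrow\delta$ to $\sigma(P,n+1)$ (all $P$); if all $\delta\in\sigma(P,n)$ for all $P$ passed this test, return SAFE, $\sigma$; otherwise increase $n$ by $1$. **Theorem.** There is an absolute constant $K$ such that for all $L$, $Th$, $\mathcal A$ and $\varphi(\vec x_M)$ as above: 1. For every $n\ge0$, BndSafety$(\mathcal A,\varphi,n,\emptyset,\emptyset)$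 terminates: it has no infinite execution, and an execution that cannot be continued has returned SAFE or UNSAFE. Moreover, in every execution, (a) for every procedure $P$ and $b\ge 0$, *Reach* infers facts for $P$ at bounds $\le b$ at most $p\,(Np+1)^b$ times; (b) *Query* is applied to a given query $\langle P,\chi,b\rangle$ at most $c\,p\,(Np+1)^b$ times; (c) the number of rule applications spent on a query $\langle P,\chi,b\rangle$, i.e. applied to it or to queries created from it by successive applications of *Query*, is at most $K\,\hat b\,\hat c^{\,b}\,(\widehat{Np})^{K b^2}$, where $\hat k=\max(k,1)$; in short, it is $O(b\,c^b\,(Np)^{O(b^2)})$; (d) the total number of rule applications is at most $K\,\hat n\,\hat c^{\,n}\,(\widehat{Np})^{K n^2}$. 2. RecMC is a co-semidecision procedure for safety: if $\mathcal A$ does not satisfy $\varphi$, then RecMC$(\mathcal A,\varphi)$ has no infinite execution and every execution that cannot be continued has returned UNSAFE. Whenever RecMC returns UNSAFE, $\rho$, there are $b$, $\delta\in\rho(M,b)$, a model $I$ of $Th$ and a tuple $\vec d\in[\![M]\!]^b_I\subseteq[\![M]\!]_I$ with $I\models\delta(\vec d)$ and $I\not\models\varphi(\vec d)$. -/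

import Mathlib

universe u v

namespace RecMC

open FirstOrder FirstOrder.Language

/-! ### Programs in logical form -/

/-- The procedure names of a program together with the numbers of their input and output
parameters.  It determines the fresh predicate symbols `Σ_Q` (one per procedure). -/
structure ProcSig where
  numProcs : ℕ
  numIn : Fin numProcs → ℕ
  numOut : Fin numProcs → ℕ

/-- The formal parameters of a procedure: its input and its output variables. -/
abbrev ProcSig.Formals (S : ProcSig) (P : Fin S.numProcs) : Type :=
  Fin (S.numIn P) ⊕ Fin (S.numOut P)

/-- Atomic formulas over the variables `V` in the signature `L` extended by the predicate symbols
`Σ_Q`; `call Q a` stands for `Σ_Q(a)`. -/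
inductive Atom (L : FirstOrder.Language.{u, v}) (S : ProcSig) (V : Type) : Type (max u v)
  | eq (t₁ t₂ : L.Term V) : Atom L S V
  | rel {k : ℕ} (R : L.Relations k) (ts : Fin k → L.Term V) : Atom L S V
  | call (Q : Fin S.numProcs) (args : S.Formals Q → L.Term V) : Atom L S V

/-- Quantifier-free formulas in the signature `L` extended by the predicate symbols `Σ_Q`. -/
inductive QF (L : FirstOrder.Language.{u, v}) (S : ProcSig) (V : Type) : Type (max u v)
  | falsum : QF L S V
  | atom (a : Atom L S V) : QF L S V
  | neg (f : QF L S V) : QF L S V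
  | and (f g : QF L S V) : QF L S V
  | or (f g : QF L S V) : QF L S V

/-- An environment maps every predicate symbol `Σ_P` to a formula over the formals of `P`. -/
abbrev Env (L : FirstOrder.Language.{u, v}) (S : ProcSig) : Type (max u v) :=
  (P : Fin S.numProcs) → L.Formula (S.Formals P)

/-- An interpretation of the predicate symbols `Σ_P` over the domain `M`. -/
abbrev Interp (S : ProcSig) (M : Type*) : Type _ :=
  (P : Fin S.numProcs) → Set (S.Formals P → M)

section QuantifierFree

variable {L : FirstOrder.Language.{u, v}} {S : ProcSig} {V : Type}

def Atom.IsCall : Atom L S V → Prop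
  | .call _ _ => True
  | _ => False

/-- Truth of an atom in the expansion of the structure `M` that interprets `Σ_Q` by `X Q`. -/
def Atom.Realize {M : Type*} [L.Structure M] (X : Interp S M) (x : V → M) : Atom L S V → Prop
  | .eq t₁ t₂ => t₁.realize x = t₂.realize x
  | .rel R ts => Structure.RelMap R fun i => (ts i).realize x
  | .call Q args => (fun i => (args i).realize x) ∈ X Q

/-- Instantiation of the predicate symbols `Σ_Q` by an environment. -/
def Atom.inst (E : Env L S) : Atom L S V → L.Formula V
  | .eq t₁ t₂ => t₁.equal t₂
  | .rel R ts => R.formula ts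
  | .call Q args => (E Q).subst args

/-- Truth value under an assignment of truth values to the atoms. -/
def QF.eval (w : Atom L S V → Prop) : QF L S V → Prop
  | .falsum => False
  | .atom a => w a
  | .neg f => ¬ f.eval w
  | .and f g => f.eval w ∧ g.eval w
  | .or f g => f.eval w ∨ g.eval w

/-- Satisfaction in the expansion of the structure `M` that interprets `Σ_Q` by `X Q`. -/
def QF.Realize {M : Type*} [L.Structure M] (X : Interp S M) (x : V → M) (f : QF L S V) : Prop :=
  f.eval (Atom.Realize X x)

/-- Instantiation of the predicate symbols `Σ_Q` by an environment. -/
def QF.inst (E : Env L S) : QF L S V → L.Formula V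
  | .falsum => ⊥
  | .atom a => a.inst E
  | .neg f => ∼(f.inst E)
  | .and f g => f.inst E ⊓ g.inst E
  | .or f g => f.inst E ⊔ g.inst E

/-- `f.CallsHavePolarity s`: every occurrence of a predicate symbol `Σ_Q` in `f` is positive
(if `s = true`), or negative (if `s = false`). -/
def QF.CallsHavePolarity : Bool → QF L S V → Prop
  | _, .falsum => True
  | s, .atom a => a.IsCall → s = true
  | s, .neg f => f.CallsHavePolarity (!s)
  | s, .and f g => f.CallsHavePolarity s ∧ g.CallsHavePolarity s
  | s, .or f g => f.CallsHavePolarity s ∧ g.CallsHavePolarity s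

/-- The occurrences of atoms, from left to right. -/
def QF.occurrences : QF L S V → List (Atom L S V)
  | .falsum => []
  | .atom a => [a]
  | .neg f => f.occurrences
  | .and f g => f.occurrences ++ g.occurrences
  | .or f g => f.occurrences ++ g.occurrences

open Classical in
/-- The atoms, without repetition, in the order of their first occurrence. -/
noncomputable def QF.atoms (f : QF L S V) : List (Atom L S V) :=
  f.occurrences.reverse.dedup.reverse

/-- A literal is an atom with a sign. -/
abbrev Literal (L : FirstOrder.Language.{u, v}) (S : ProcSig) (V : Type) : Type (max u v) :=
  Atom L S V × Bool

def Literal.eval (w : Atom L S V → Prop) (l : Literal L S V) : Prop :=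
  if l.2 then w l.1 else ¬ w l.1

def Literal.inst (E : Env L S) (l : Literal L S V) : L.Formula V :=
  if l.2 then l.1.inst E else ∼(l.1.inst E)

/-- Instantiation of a conjunction of literals by an environment. -/
def instConj (E : Env L S) (π : List (Literal L S V)) : L.Formula V :=
  π.foldr (fun l φ => Literal.inst E l ⊓ φ) ⊤

/-- The conjunction of the literals in `π` implies `f` propositionally. -/
def IsImplicant (f : QF L S V) (π : List (Literal L S V)) : Prop :=
  ∀ w : Atom L S V → Prop, (∀ l ∈ π, Literal.eval w l) → f.eval w

/-- `π` is a prime implicant of `f`: a conjunction of literals over pairwise distinct atoms of `f`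
that implies `f` and none of whose proper sub-conjunctions implies `f`.  To make prefixes and
suffixes meaningful, the literals are listed in the order of the atoms of `f`. -/
def IsPrimeImplicant (f : QF L S V) (π : List (Literal L S V)) : Prop :=
  (π.map Prod.fst).Sublist f.atoms ∧ IsImplicant f π ∧
    ∀ π' : List (Literal L S V), π'.Sublist π → π' ≠ π → ¬ IsImplicant f π'

theorem finite_primeImplicants (f : QF L S V) : {π | IsPrimeImplicant f π}.Finite := by
  have key : ∀ as : List (Atom L S V),
      {π : List (Literal L S V) | (π.map Prod.fst).Sublist as}.Finite := by
    intro as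
    induction as with
    | nil => exact (Set.finite_singleton []).subset fun π h => by simpa using h
    | cons a as ih =>
      refine (ih.union ((ih.image (List.cons (a, true))).union
        (ih.image (List.cons (a, false))))).subset ?_
      intro π h
      rcases π with _ | ⟨⟨a', s⟩, π⟩
      · left; simp
      · simp only [Set.mem_ofPred_eq, List.map_cons] at h
        cases h with
        | cons _ h => left; simpa using h
        | cons_cons _ h =>
          right
          cases s
          · right; exact ⟨π, h, rfl⟩
          · left; exact ⟨π, h, rfl⟩
  exact (key f.atoms).subset fun π h => h.1

open Classical in
/-- The number of procedure calls along a path. -/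
noncomputable def numCalls (π : List (Literal L S V)) : ℕ :=
  π.countP fun l => decide l.1.IsCall

end QuantifierFree

/-- A program: a finite list of procedures with a main procedure; each procedure has input and
output parameters, local variables, and a body, which is a quantifier-free formula in which the
predicate symbols `Σ_Q` occur only positively. -/
structure Program (L : FirstOrder.Language.{u, v}) extends ProcSig where
  main : Fin numProcs
  numLocals : Fin numProcs → ℕ
  body : (P : Fin numProcs) → QF L toProcSig (toProcSig.Formals P ⊕ Fin (numLocals P))
  body_positive : ∀ P, (body P).CallsHavePolarity true

namespace Program

variable {L : FirstOrder.Language.{u, v}} (A : Program L)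

abbrev Proc : Type := Fin A.numProcs

abbrev Formals (P : A.Proc) : Type := A.toProcSig.Formals P

abbrev Locals (P : A.Proc) : Type := Fin (A.numLocals P)

abbrev Vars (P : A.Proc) : Type := A.Formals P ⊕ A.Locals P

/-- The paths of a procedure are the prime implicants of its body. -/
noncomputable def paths (P : A.Proc) : Finset (List (Literal L A.toProcSig (A.Vars P))) :=
  (finite_primeImplicants (A.body P)).toFinset

/-- The maximal number of paths in a procedure. -/
noncomputable def maxPaths : ℕ :=
  Finset.univ.sup fun P : A.Proc => (A.paths P).card

/-- The maximal number of procedure calls along a path. -/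
noncomputable def maxCalls : ℕ :=
  Finset.univ.sup fun P : A.Proc => (A.paths P).sup numCalls

/-! ### Semantics -/

section Semantics

variable (M : Type*) [L.Structure M]

/-- The set defined by `∃ locals, body` when `Σ_Q` is interpreted by `X Q`. -/
def bodySet (X : Interp A.toProcSig M) (P : A.Proc) : Set (A.Formals P → M) :=
  {x | ∃ y : A.Locals P → M, (A.body P).Realize X (Sum.elim x y)}

/-- The semantics of the procedures: the pointwise least interpretation that satisfies
`∀ formals locals, body → Σ_Q(formals)` for all `Q`. -/
def sem : Interp A.toProcSig M :=
  sInf {X : Interp A.toProcSig M | ∀ Q, ∀ x : A.Formals Q → M, ∀ y : A.Locals Q → M,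
    (A.body Q).Realize X (Sum.elim x y) → x ∈ X Q}

/-- The semantics with call stack bounded by `b`. -/
def boundedSem : ℕ → Interp A.toProcSig M
  | 0 => A.bodySet M fun _ => ∅
  | b + 1 => A.bodySet M (boundedSem b)

end Semantics

/-- The program satisfies the safety property `φ` modulo the theory `T`. -/
def Satisfies (T : L.Theory) (φ : L.Formula (A.Formals A.main)) : Prop :=
  ∀ I : Theory.ModelType.{u, v, max u v} T, ∀ x : A.Formals A.main → I,
    x ∈ A.sem I A.main → φ.Realize x

/-! ### Bounded assertion maps -/

/-- A triple `⟨P, φ, b⟩` of a procedure, a formula over its formals and a bound. -/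
structure Triple where
  proc : A.Proc
  fml : L.Formula (A.Formals proc)
  bound : ℕ

/-- A (finite) bounded assertion map `m`, as the set of all `⟨P, δ, b⟩` with `δ ∈ m(P, b)`. -/
abbrev AMap : Type (max u v) := Finset A.Triple

variable {A}

theorem AMap.finite_fmls (m : A.AMap) (P : A.Proc) (C : ℕ → Prop) :
    Finite {δ : L.Formula (A.Formals P) // ∃ b, C b ∧ (⟨P, δ, b⟩ : A.Triple) ∈ m} := by
  have h : ((fun δ : L.Formula (A.Formals P) => (⟨P, δ⟩ :
      (P : A.Proc) × L.Formula (A.Formals P))) ⁻¹'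
      ((fun t : A.Triple => (⟨t.proc, t.fml⟩ : (P : A.Proc) × L.Formula (A.Formals P))) ''
        (m : Set A.Triple))).Finite :=
    (m.finite_toSet.image _).preimage fun δ _ δ' _ h => by simpa using h
  have h' : {δ : L.Formula (A.Formals P) | ∃ b, C b ∧ (⟨P, δ, b⟩ : A.Triple) ∈ m}.Finite := by
    refine h.subset ?_
    rintro δ ⟨b, _, hb⟩
    exact ⟨_, hb, rfl⟩
  exact h'.to_subtype

/-- The environment `U_m^b`, mapping `Σ_P` to `⋁ {δ ∈ m(P, b') | b' ≤ b}`. -/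
noncomputable def underEnv (m : A.AMap) (b : ℕ) : Env L A.toProcSig := fun P =>
  haveI := m.finite_fmls P (· ≤ b)
  Formula.iSup fun δ : {δ : L.Formula (A.Formals P) //
    ∃ b', b' ≤ b ∧ (⟨P, δ, b'⟩ : A.Triple) ∈ m} => δ.1

/-- The environment `O_m^b`, mapping `Σ_P` to `⋀ {δ ∈ m(P, b') | b' ≥ b}`. -/
noncomputable def overEnv (m : A.AMap) (b : ℕ) : Env L A.toProcSig := fun P =>
  haveI := m.finite_fmls P (b ≤ ·)
  Formula.iInf fun δ : {δ : L.Formula (A.Formals P) //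
    ∃ b', b ≤ b' ∧ (⟨P, δ, b'⟩ : A.Triple) ∈ m} => δ.1

/-- `U_m^{b-1}`, where `U_m^{-1}` maps every symbol to `⊥`. -/
noncomputable def underEnvPred (m : A.AMap) : ℕ → Env L A.toProcSig
  | 0 => fun _ => ⊥
  | b + 1 => underEnv m b

/-- `O_m^{b-1}`, where `O_m^{-1}` maps every symbol to `⊥`. -/
noncomputable def overEnvPred (m : A.AMap) : ℕ → Env L A.toProcSig
  | 0 => fun _ => ⊥
  | b + 1 => overEnv m b

/-! ### The transition system `BndSafety` -/

/-- The reachability fact `∃ locals, π` obtained from a path with instantiated calls. -/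
noncomputable def reachFact (ρ : A.AMap) (P : A.Proc) (b : ℕ)
    (π : List (Literal L A.toProcSig (A.Vars P))) : L.Formula (A.Formals P) :=
  Formula.iExs (A.Locals P) (instConj (underEnvPred ρ b) π)

/-- The formula of the new query for the callee `R` of the call `Σ_R(a)`: over the formals `z` of
`R` it says that `z = a` and `θ` hold for some values of the variables of the caller `P`.  When `a`
consists of distinct variables, this is `∃` over the remaining variables of `θ`, with `a` renamed
to the formals of `R`. -/
noncomputable def callQuery {P : A.Proc} (R : A.Proc) (a : A.Formals R → L.Term (A.Vars P))
    (θ : L.Formula (A.Vars P)) : L.Formula (A.Formals R) :=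
  Formula.iExs (A.Vars P)
    (θ.relabel Sum.inr ⊓
      Formula.iInf fun i : A.Formals R =>
        (Term.var (Sum.inl i) : L.Term (A.Formals R ⊕ A.Vars P)).equal ((a i).relabel Sum.inr))

variable (A) in
/-- States of `BndSafety`: `running Q ρ σ`, and the two results together with the final maps. -/
inductive State : Type (max u v)
  | running (Q : Set A.Triple) (ρ σ : A.AMap) : State
  | resUnsafe (ρ σ : A.AMap) : State
  | resSafe (ρ σ : A.AMap) : State

def State.IsFinal : A.State → Prop
  | .running _ _ _ => False
  | .resUnsafe _ _ => True
  | .resSafe _ _ => True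

variable (A) in
/-- Rule applications.  `sum q` and `reach q` answer the query `q`, and `query q q'` creates the
query `q'` from the query `q`. -/
inductive RuleApp : Type (max u v)
  | sum (q : A.Triple) : RuleApp
  | reach (q : A.Triple) : RuleApp
  | query (q q' : A.Triple) : RuleApp
  | resUnsafe : RuleApp
  | resSafe : RuleApp

/-- The rule application is an application of a rule to the query `q`. -/
def RuleApp.On (q : A.Triple) : A.RuleApp → Prop
  | .sum q₀ => q₀ = q
  | .reach q₀ => q₀ = q
  | .query q₀ _ => q₀ = q
  | .resUnsafe => False
  | .resSafe => False

/-- The initial state, produced by the rule `Init`. -/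
def init (φ : L.Formula (A.Formals A.main)) (n : ℕ) (ρ σ : A.AMap) : A.State :=
  .running {⟨A.main, ∼φ, n⟩} ρ σ

open Classical in
/-- The rules of `BndSafety` for the safety property `φ` and the bound `n`.  In `sum`, the
interpolant `ψ` may be any formula with the required property.  In `query`, the bound of the
query is positive since the new query has to have a bound in `ℕ`. -/
inductive Step (T : L.Theory) (φ : L.Formula (A.Formals A.main)) (n : ℕ) :
    A.State → A.RuleApp → A.State → Prop
  | sum (Q : Set A.Triple) (ρ σ : A.AMap) (P : A.Proc) (χ : L.Formula (A.Formals P)) (b : ℕ)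
      (ψ : L.Formula (A.Formals P))
      (mem : (⟨P, χ, b⟩ : A.Triple) ∈ Q)
      (blocked : T ⊨ᵇ ((A.body P).inst (overEnvPred σ b)).imp (∼(χ.relabel Sum.inl)))
      (itp_left : T ⊨ᵇ ((A.body P).inst (overEnvPred σ b)).imp (ψ.relabel Sum.inl))
      (itp_right : T ⊨ᵇ ψ.imp (∼χ)) :
      Step T φ n (.running Q ρ σ) (.sum ⟨P, χ, b⟩)
        (.running
          (Q \ {q | ∃ (η : L.Formula (A.Formals P)) (c : ℕ), q = ⟨P, η, c⟩ ∧ c ≤ b ∧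
            T ⊨ᵇ (overEnv σ c P ⊓ ψ).imp (∼η)})
          ρ (insert ⟨P, ψ, b⟩ σ))
  | reach (Q : Set A.Triple) (ρ σ : A.AMap) (P : A.Proc) (χ : L.Formula (A.Formals P)) (b : ℕ)
      (π : List (Literal L A.toProcSig (A.Vars P)))
      (mem : (⟨P, χ, b⟩ : A.Triple) ∈ Q)
      (path : π ∈ A.paths P)
      (feasible : ¬ T ⊨ᵇ (instConj (underEnvPred ρ b) π).imp (∼(χ.relabel Sum.inl))) :
      Step T φ n (.running Q ρ σ) (.reach ⟨P, χ, b⟩)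
        (.running
          (Q \ {q | ∃ (η : L.Formula (A.Formals P)) (c : ℕ), q = ⟨P, η, c⟩ ∧ b ≤ c ∧
            ¬ T ⊨ᵇ (reachFact ρ P b π).imp (∼η)})
          (insert ⟨P, reachFact ρ P b π, b⟩ ρ) σ)
  | query (Q : Set A.Triple) (ρ σ : A.AMap) (P : A.Proc) (χ : L.Formula (A.Formals P)) (b : ℕ)
      (πu πv : List (Literal L A.toProcSig (A.Vars P)))
      (R : A.Proc) (a : A.Formals R → L.Term (A.Vars P)) (ψ : L.Formula (A.Formals R))
      (mem : (⟨P, χ, b + 1⟩ : A.Triple) ∈ Q)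
      (unreached : T ⊨ᵇ ((A.body P).inst (underEnv ρ b)).imp (∼(χ.relabel Sum.inl)))
      (path : πu ++ (Atom.call R a, true) :: πv ∈ A.paths P)
      (under_blocks : T ⊨ᵇ (instConj (overEnv σ b) πu ⊓ (Atom.call R a).inst (underEnv ρ b) ⊓
        instConj (underEnv ρ b) πv).imp (∼(χ.relabel Sum.inl)))
      (over_allows : ¬ T ⊨ᵇ (instConj (overEnv σ b) πu ⊓ (Atom.call R a).inst (overEnv σ b) ⊓
        instConj (underEnv ρ b) πv).imp (∼(χ.relabel Sum.inl)))
      (new_query : ψ = callQuery R a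
        (instConj (overEnv σ b) πu ⊓ instConj (underEnv ρ b) πv ⊓ χ.relabel Sum.inl))
      (no_overlap : ∀ η : L.Formula (A.Formals R), (⟨R, η, b⟩ : A.Triple) ∈ Q →
        T ⊨ᵇ ψ.imp (∼η)) :
      Step T φ n (.running Q ρ σ) (.query ⟨P, χ, b + 1⟩ ⟨R, ψ, b⟩)
        (.running (Q ∪ {⟨R, ψ, b⟩}) ρ σ)
  | resUnsafe (ρ σ : A.AMap)
      (reached : ¬ T ⊨ᵇ (underEnv ρ n A.main).imp φ) :
      Step T φ n (.running ∅ ρ σ) .resUnsafe (.resUnsafe ρ σ)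
  | resSafe (ρ σ : A.AMap)
      (blocked : T ⊨ᵇ (overEnv σ n A.main).imp φ) :
      Step T φ n (.running ∅ ρ σ) .resSafe (.resSafe ρ σ)

/-- `Run T φ n s rs s'`: the rule applications `rs`, in this order, lead from `s` to `s'`. -/
inductive Run (T : L.Theory) (φ : L.Formula (A.Formals A.main)) (n : ℕ) (s : A.State) :
    List A.RuleApp → A.State → Prop
  | nil : Run T φ n s [] s
  | snoc {rs : List A.RuleApp} {s' s'' : A.State} {r : A.RuleApp} :
      Run T φ n s rs s' → Step T φ n s' r s'' → Run T φ n s (rs ++ [r]) s''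

/-- One application of some rule. -/
def BndStep (T : L.Theory) (φ : L.Formula (A.Formals A.main)) (n : ℕ) (s s' : A.State) : Prop :=
  ∃ r, Step T φ n s r s'

open Classical in
/-- The number of applications of `Reach` that update `U_ρ^b` for `Σ_P`, i.e. that infer a
reachability fact for `P` at a bound `b' ≤ b`. -/
noncomputable def numReach (rs : List A.RuleApp) (P : A.Proc) (b : ℕ) : ℕ :=
  rs.countP fun r => decide (∃ q : A.Triple, r = .reach q ∧ q.proc = P ∧ q.bound ≤ b)

open Classical in
/-- The number of applications of `Query` to the query `q`. -/
noncomputable def numQuery (rs : List A.RuleApp) (q : A.Triple) : ℕ :=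
  rs.countP fun r => decide (∃ q', r = .query q q')

/-- `q'` is `q` or was created by successive applications of `Query` starting from `q`. -/
def Descends (rs : List A.RuleApp) (q q' : A.Triple) : Prop :=
  Relation.ReflTransGen (fun q₁ q₂ => RuleApp.query q₁ q₂ ∈ rs) q q'

open Classical in
/-- The number of rule applications spent on answering the query `q`: those applied to `q` or to
a query descending from `q`. -/
noncomputable def work (rs : List A.RuleApp) (q : A.Triple) : ℕ :=
  rs.countP fun r => decide (∃ q', Descends rs q q' ∧ r.On q')

/-! ### The main loop `RecMC` -/

/-- The first result of `CheckInductive`: all summary facts at bound `n` can be pushed. -/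
def IsInductive (T : L.Theory) (σ : A.AMap) (n : ℕ) : Prop :=
  ∀ (P : A.Proc) (δ : L.Formula (A.Formals P)), (⟨P, δ, n⟩ : A.Triple) ∈ σ →
    T ⊨ᵇ ((A.body P).inst (overEnv σ n)).imp (δ.relabel Sum.inl)

open Classical in
/-- The second result of `CheckInductive`: the summary facts at bound `n` that can be pushed are
added at bound `n + 1`.  (Adding them one by one does not change the environment `O_σ^n` in the
test, since they already belong to `σ` at bound `n`.) -/
noncomputable def push (T : L.Theory) (σ : A.AMap) (n : ℕ) : A.AMap :=
  σ ∪ (σ.filter fun t => t.bound = n ∧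
    T ⊨ᵇ ((A.body t.proc).inst (overEnv σ n)).imp (t.fml.relabel Sum.inl)).image
      fun t => ⟨t.proc, t.fml, n + 1⟩

variable (A) in
/-- States of `RecMC`: executing `BndSafety` with bound `n`, or having returned
`UNSAFE, ρ` or `SAFE, σ`. -/
inductive RecState : Type (max u v)
  | bnd (n : ℕ) (s : A.State) : RecState
  | retUnsafe (ρ : A.AMap) : RecState
  | retSafe (σ : A.AMap) : RecState

def RecState.IsUnsafe : A.RecState → Prop
  | .retUnsafe _ => True
  | _ => False

/-- The initial state of `RecMC`: the call of `BndSafety` with bound `0` and empty maps. -/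
def recInit (φ : L.Formula (A.Formals A.main)) : A.RecState :=
  .bnd 0 (init φ 0 ∅ ∅)

/-- The steps of the main loop; a step is a rule application inside the current call of
`BndSafety`, or the treatment of its result. -/
inductive RecStep (T : L.Theory) (φ : L.Formula (A.Formals A.main)) :
    A.RecState → A.RecState → Prop
  | inner (n : ℕ) (s s' : A.State) (h : BndStep T φ n s s') :
      RecStep T φ (.bnd n s) (.bnd n s')
  | retUnsafe (n : ℕ) (ρ σ : A.AMap) :
      RecStep T φ (.bnd n (.resUnsafe ρ σ)) (.retUnsafe ρ)
  | retSafe (n : ℕ) (ρ σ : A.AMap) (h : IsInductive T σ n) :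
      RecStep T φ (.bnd n (.resSafe ρ σ)) (.retSafe (push T σ n))
  | next (n : ℕ) (ρ σ : A.AMap) (h : ¬ IsInductive T σ n) :
      RecStep T φ (.bnd n (.resSafe ρ σ)) (.bnd (n + 1) (init φ (n + 1) ρ (push T σ n)))

end Program

/-- Termination of a nondeterministic transition system started in `s₀`: there is no infinite
execution, and an execution that cannot be continued has ended in a final state. -/
def Terminates {α : Type*} (step : α → α → Prop) (s₀ : α) (final : α → Prop) : Prop :=
  (¬ ∃ s : ℕ → α, s 0 = s₀ ∧ ∀ i, step (s i) (s (i + 1))) ∧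
    ∀ s, Relation.ReflTransGen step s₀ s → (¬ ∃ s', step s s') → final s

end RecMC

/-! Termination with bounds is an accounting argument. The maps `ρ` and `σ` only grow, no open query
ever meets a known reachability fact (`Step.unreached`), and an answered query stays answered and is
never created again (`Step.mem_or_not_answered`). Applying `Reach` to a fixed path at bound b infers
a formula that depends only on the facts of `ρ` below b. Had this formula been known already, the
query could not have been open, so two such applications are separated by a `Reach` at a bound below
b. Likewise, repeating `Query` at a fixed call position of a query at bound b requires a `Reach`
below b in between. Otherwise the new child query implies the old one, because `σ` only strengthens
the prefix of the path, and the old one is still open or blocked.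

With X = Np and r(b) the number of `Reach` applications below b, this gives r(b+1) ≤ X · ∑_{i≤b} (1
+ r(i)), hence 1 + r(b) ≤ (X+1)^b (`Accounting.reachesBelow_le`). Bound (b) follows by counting call
positions. For the sharper bound (a), with initially empty `ρ`, a path with calls cannot be reached
before some fact exists below it, which saves one application, and a call-free path is reached at
most once per bound (`Accounting.numReach_le`). The work on a query is at most one answer plus its
`Query` applications plus the work on its children (`Accounting.work_le`). Solving this recursion
gives (c), and (d) since all rules but the returning one are applied to descendants of the initial
query.

Progress (`exists_step_of_mem`): at an open query of least bound, if neither `Sum` nor `Reach`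
applies, some path is satisfiable with over-approximated calls but not with under-approximated ones.
Switching the calls one at a time, from left to right, locates the call for `Query`.

For `RecMC`, the maps are sound for the bounded semantics (`SoundMaps`), and the least
interpretation is the union of the bounded ones, as bodies are positive and have finitely many
atoms. A counterexample thus appears at some finite bound B, and no call of `BndSafety` with bound
at least B can return SAFE. SAFE is returned by the main loop only with an inductive
over-approximation (`satisfies_of_isInductive`), so never for an unsafe program. -/

/-! ### Semantics of instantiated formulas -/

namespace RecMC

open FirstOrder FirstOrder.Language

section QuantifierFree

variable {L : FirstOrder.Language.{u, v}} {S : ProcSig} {V : Type}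

/-- The interpretation of the predicate symbols defined by an environment. -/
def Env.interp (E : Env L S) (M : Type*) [L.Structure M] : Interp S M :=
  fun P => {y | (E P).Realize y}

theorem models_imp_iff {T : L.Theory} {α β : L.Formula V} :
    T ⊨ᵇ α.imp β ↔
      ∀ (I : Theory.ModelType.{u, v, max u v} T) (x : V → I), α.Realize x → β.Realize x := by
  rw [Theory.models_formula_iff]
  simp only [Formula.realize_imp]

theorem models_imp_not_iff {T : L.Theory} {α β : L.Formula V} :
    T ⊨ᵇ α.imp (∼β) ↔
      ∀ (I : Theory.ModelType.{u, v, max u v} T) (x : V → I), α.Realize x → ¬ β.Realize x := by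
  rw [models_imp_iff]
  simp only [Formula.realize_not]

theorem not_models_imp_not_iff {T : L.Theory} {α β : L.Formula V} :
    ¬ T ⊨ᵇ α.imp (∼β) ↔
      ∃ (I : Theory.ModelType.{u, v, max u v} T) (x : V → I), α.Realize x ∧ β.Realize x := by
  rw [models_imp_not_iff]
  push Not
  rfl

variable {M : Type*} [L.Structure M]

theorem Atom.realize_inst (E : Env L S) (a : Atom L S V) (x : V → M) :
    (a.inst E).Realize x ↔ a.Realize (E.interp M) x := by
  cases a with
  | eq t₁ t₂ => simp [Atom.inst, Atom.Realize]
  | rel R ts => simp [Atom.inst, Atom.Realize]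
  | call Q args => exact BoundedFormula.realize_subst

theorem QF.realize_inst (E : Env L S) (f : QF L S V) (x : V → M) :
    (f.inst E).Realize x ↔ f.Realize (E.interp M) x := by
  induction f with
  | falsum => simp [QF.inst, QF.Realize, QF.eval]
  | atom a => exact a.realize_inst E x
  | neg f ih => simpa [QF.inst, QF.Realize, QF.eval] using not_congr ih
  | and f g ihf ihg => simpa [QF.inst, QF.Realize, QF.eval] using and_congr ihf ihg
  | or f g ihf ihg => simpa [QF.inst, QF.Realize, QF.eval] using or_congr ihf ihg

/-- Truth of a conjunction of literals. -/
def ConjRealize (X : Interp S M) (x : V → M) (π : List (Literal L S V)) : Prop :=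
  ∀ l ∈ π, Literal.eval (Atom.Realize X x) l

@[simp]
theorem conjRealize_nil (X : Interp S M) (x : V → M) :
    ConjRealize X x ([] : List (Literal L S V)) := by
  simp [ConjRealize]

@[simp]
theorem conjRealize_cons (X : Interp S M) (x : V → M) (l : Literal L S V)
    (π : List (Literal L S V)) :
    ConjRealize X x (l :: π) ↔ Literal.eval (Atom.Realize X x) l ∧ ConjRealize X x π := by
  simp [ConjRealize]

@[simp]
theorem conjRealize_append (X : Interp S M) (x : V → M) (π π' : List (Literal L S V)) :
    ConjRealize X x (π ++ π') ↔ ConjRealize X x π ∧ ConjRealize X x π' := by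
  simp [ConjRealize, or_imp, forall_and]

theorem Literal.realize_inst (E : Env L S) (l : Literal L S V) (x : V → M) :
    (Literal.inst E l).Realize x ↔ Literal.eval (Atom.Realize (E.interp M) x) l := by
  unfold Literal.inst Literal.eval
  split
  · exact l.1.realize_inst E x
  · exact not_congr (l.1.realize_inst E x)

theorem realize_instConj (E : Env L S) (π : List (Literal L S V)) (x : V → M) :
    (instConj E π).Realize x ↔ ConjRealize (E.interp M) x π := by
  induction π with
  | nil => simp [instConj]
  | cons l π ih =>
    rw [conjRealize_cons, ← ih, ← Literal.realize_inst]
    simp [instConj]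

/-! ### Monotonicity in the predicate symbols -/

/-- The polarity is a parameter because negation reverses both it and the implication. Only atoms
occurring in `f` are compared; `QF.realize_iUnion` and prime implicants of a positive body both rest
on this lemma. -/
theorem QF.eval_mono {w w' : Atom L S V → Prop} (f : QF L S V) :
    ∀ s : Bool, f.CallsHavePolarity s →
      (∀ a ∈ f.occurrences, a.IsCall → w a → w' a) →
      (∀ a ∈ f.occurrences, ¬ a.IsCall → (w a ↔ w' a)) →
      if s then f.eval w → f.eval w' else f.eval w' → f.eval w := by
  induction f with
  | falsum => intro s; cases s <;> simp [QF.eval]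
  | atom a =>
    intro s hs h₁ h₂
    simp only [QF.occurrences, List.mem_singleton, forall_eq] at h₁ h₂
    simp only [QF.CallsHavePolarity] at hs
    by_cases ha : a.IsCall
    · rw [hs ha]
      exact h₁ ha
    · cases s
      · exact (h₂ ha).2
      · exact (h₂ ha).1
  | neg f ih =>
    intro s hs h₁ h₂
    have := ih (!s) hs h₁ h₂
    cases s
    · exact fun h h' => h (this h')
    · exact fun h h' => h (this h')
  | and f g ihf ihg =>
    intro s hs h₁ h₂
    simp only [QF.occurrences, List.mem_append, or_imp, forall_and] at h₁ h₂
    have hf := ihf s hs.1 h₁.1 h₂.1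
    have hg := ihg s hs.2 h₁.2 h₂.2
    cases s
    · exact fun h => ⟨hf h.1, hg h.2⟩
    · exact fun h => ⟨hf h.1, hg h.2⟩
  | or f g ihf ihg =>
    intro s hs h₁ h₂
    simp only [QF.occurrences, List.mem_append, or_imp, forall_and] at h₁ h₂
    have hf := ihf s hs.1 h₁.1 h₂.1
    have hg := ihg s hs.2 h₁.2 h₂.2
    cases s
    · exact fun h => h.imp hf hg
    · exact fun h => h.imp hf hg

theorem QF.eval_congr {w w' : Atom L S V → Prop} (f : QF L S V)
    (h : ∀ a ∈ f.occurrences, (w a ↔ w' a)) : f.eval w ↔ f.eval w' := by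
  induction f with
  | falsum => rfl
  | atom a => exact h a (by simp [QF.occurrences])
  | neg f ih => exact not_congr (ih h)
  | and f g ihf ihg =>
    simp only [QF.occurrences, List.mem_append, or_imp, forall_and] at h
    exact and_congr (ihf h.1) (ihg h.2)
  | or f g ihf ihg =>
    simp only [QF.occurrences, List.mem_append, or_imp, forall_and] at h
    exact or_congr (ihf h.1) (ihg h.2)

theorem Atom.realize_mono {X Y : Interp S M} (h : ∀ P, X P ⊆ Y P) (x : V → M) {a : Atom L S V}
    (ha : a.Realize X x) : a.Realize Y x := by
  cases a with
  | eq t₁ t₂ => exact ha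
  | rel R ts => exact ha
  | call Q args => exact h Q ha

theorem Atom.realize_congr_of_not_isCall {X Y : Interp S M} (x : V → M) {a : Atom L S V}
    (ha : ¬ a.IsCall) : a.Realize X x ↔ a.Realize Y x := by
  cases a with
  | eq t₁ t₂ => rfl
  | rel R ts => rfl
  | call Q args => exact absurd trivial ha

theorem QF.realize_mono {X Y : Interp S M} (h : ∀ P, X P ⊆ Y P) {f : QF L S V}
    (hf : f.CallsHavePolarity true) {x : V → M} (hx : f.Realize X x) : f.Realize Y x := by
  have := QF.eval_mono (w := Atom.Realize X x) (w' := Atom.Realize Y x) f true hf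
    (fun a _ _ ha => Atom.realize_mono h x ha)
    (fun a _ ha => Atom.realize_congr_of_not_isCall x ha)
  exact this hx

/-- Compactness for a finite formula: each of its finitely many atoms that holds in the union holds
at some stage, and the maximum of these stages serves all of them. -/
theorem QF.realize_iUnion {X : ℕ → Interp S M} (hX : ∀ b c, b ≤ c → ∀ P, X b P ⊆ X c P)
    {f : QF L S V} (hf : f.CallsHavePolarity true) {x : V → M}
    (hx : f.Realize (fun P => ⋃ b, X b P) x) : ∃ b, f.Realize (X b) x := by
  have key : ∀ as : List (Atom L S V), ∃ b, ∀ a ∈ as,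
      a.Realize (fun P => ⋃ b, X b P) x → a.Realize (X b) x := by
    intro as
    induction as with
    | nil => exact ⟨0, by simp⟩
    | cons a as ih =>
      obtain ⟨b, hb⟩ := ih
      by_cases h : a.Realize (fun P => ⋃ b, X b P) x
      · obtain ⟨c, hc⟩ : ∃ c, a.Realize (X c) x := by
          cases a with
          | eq t₁ t₂ => exact ⟨0, h⟩
          | rel R ts => exact ⟨0, h⟩
          | call Q args =>
            obtain ⟨c, hc⟩ := Set.mem_iUnion.1 h
            exact ⟨c, hc⟩
        refine ⟨max b c, fun a' ha' h' => ?_⟩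
        rcases List.mem_cons.1 ha' with rfl | ha'
        · exact Atom.realize_mono (hX _ _ (le_max_right _ _)) x hc
        · exact Atom.realize_mono (hX _ _ (le_max_left _ _)) x (hb a' ha' h')
      · refine ⟨b, fun a' ha' h' => ?_⟩
        rcases List.mem_cons.1 ha' with rfl | ha'
        · exact absurd h' h
        · exact hb a' ha' h'
  obtain ⟨b, hb⟩ := key f.occurrences
  have := QF.eval_mono (w := Atom.Realize (fun P => ⋃ b, X b P) x) (w' := Atom.Realize (X b) x)
    f true hf (fun a ha _ h => hb a ha h)
    (fun a _ ha => Atom.realize_congr_of_not_isCall x ha)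
  exact ⟨b, this hx⟩

/-! ### Prime implicants -/

theorem QF.mem_atoms {f : QF L S V} {a : Atom L S V} : a ∈ f.atoms ↔ a ∈ f.occurrences := by
  classical
  simp [QF.atoms]

theorem QF.nodup_atoms (f : QF L S V) : f.atoms.Nodup := by
  classical
  simpa [QF.atoms] using List.nodup_dedup f.occurrences.reverse

/-- The complete description of `w` on the atoms of `f` is an implicant; a shortest subconjunction
that is still an implicant is prime. -/
theorem exists_primeImplicant {f : QF L S V} {w : Atom L S V → Prop} (hw : f.eval w) :
    ∃ π, IsPrimeImplicant f π ∧ ∀ l ∈ π, Literal.eval w l := by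
  classical
  let π₀ : List (Literal L S V) := f.atoms.map fun a => (a, decide (w a))
  have hπ₀ : IsImplicant f π₀ := by
    intro w' hw'
    refine (QF.eval_congr f fun a ha => ?_).1 hw
    have := hw' (a, decide (w a)) (List.mem_map.2 ⟨a, QF.mem_atoms.2 ha, rfl⟩)
    by_cases h : w a <;> simpa [Literal.eval, h] using this
  have hex : ∃ k, ∃ π : List (Literal L S V), π.Sublist π₀ ∧ IsImplicant f π ∧ π.length = k :=
    ⟨_, π₀, List.Sublist.refl _, hπ₀, rfl⟩
  obtain ⟨π, hsub, himp, hlen⟩ := Nat.find_spec hex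
  refine ⟨π, ⟨?_, himp, ?_⟩, ?_⟩
  · simpa [π₀, Function.comp_def] using hsub.map Prod.fst
  · intro π' hπ' hne himp'
    have hlt : π'.length < π.length :=
      lt_of_le_of_ne hπ'.length_le fun h => hne (hπ'.eq_of_length h)
    exact Nat.find_min hex (hlen ▸ hlt) ⟨π', hπ'.trans hsub, himp', rfl⟩
  · intro l hl
    obtain ⟨a, -, rfl⟩ := List.mem_map.1 (hsub.subset hl)
    by_cases h : w a <;> simp [Literal.eval, h]

theorem IsPrimeImplicant.nodup {f : QF L S V} {π : List (Literal L S V)}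
    (hπ : IsPrimeImplicant f π) : (π.map Prod.fst).Nodup :=
  hπ.1.nodup f.nodup_atoms

/-- A negative call literal could be dropped: make its atom false, so that the whole conjunction and
hence `f` holds, then return to the original assignment by monotonicity. This contradicts primality.
-/
theorem IsPrimeImplicant.call_pos {f : QF L S V} {π : List (Literal L S V)}
    (hπ : IsPrimeImplicant f π) (hf : f.CallsHavePolarity true) {l : Literal L S V}
    (hl : l ∈ π) (hcall : l.1.IsCall) : l.2 = true := by
  classical
  by_contra hneg
  obtain ⟨a, s⟩ := l
  obtain rfl : s = false := by simpa using hneg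
  obtain ⟨π₁, π₂, rfl⟩ := List.append_of_mem hl
  refine hπ.2.2 (π₁ ++ π₂) (by simp) ?_ ?_
  · intro h
    have := congrArg List.length h
    simp at this
  · intro w hw
    have hnd := hπ.nodup
    simp only [List.map_append, List.map_cons] at hnd
    have hnot := List.nodup_middle.1 hnd
    rw [List.nodup_cons] at hnot
    let w' : Atom L S V → Prop := fun a' => a' ≠ a ∧ w a'
    have h' : f.eval w' := by
      refine hπ.2.1 w' fun l' hl' => ?_
      by_cases h : l' = (a, false)
      · subst h
        simp [Literal.eval, w']
      · have hmem : l' ∈ π₁ ++ π₂ := by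
          simp only [List.mem_append, List.mem_cons] at hl' ⊢
          tauto
        have hne : l'.1 ≠ a := by
          intro he
          apply hnot.1
          rw [← List.map_append, ← he]
          exact List.mem_map_of_mem hmem
        have := hw l' hmem
        unfold Literal.eval at this ⊢
        simpa [w', hne] using this
    have := QF.eval_mono (w := w') (w' := w) f true hf (fun a' _ _ h => h.2)
      (fun a' _ ha' => by
        have : a' ≠ a := fun h => ha' (h ▸ hcall)
        simp [w', this])
    exact this h'

theorem conjRealize_mono {X Y : Interp S M} (h : ∀ P, X P ⊆ Y P) {π : List (Literal L S V)}
    (hπ : ∀ l ∈ π, l.1.IsCall → l.2 = true) {x : V → M} (hx : ConjRealize X x π) :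
    ConjRealize Y x π := by
  intro l hl
  have hl' := hx l hl
  unfold Literal.eval at hl' ⊢
  by_cases hc : l.1.IsCall
  · simp only [hπ l hl hc, if_true] at hl' ⊢
    exact Atom.realize_mono h x hl'
  · rwa [Atom.realize_congr_of_not_isCall (Y := Y) x hc] at hl'

theorem Literal.inst_congr_of_not_isCall (E E' : Env L S)
    {l : Literal L S V} (hl : ¬ l.1.IsCall) : l.inst E = l.inst E' := by
  obtain ⟨a, s⟩ := l
  cases a with
  | eq t₁ t₂ => rfl
  | rel R ts => rfl
  | call Q args => exact absurd trivial hl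

theorem instConj_congr_of_no_call (E E' : Env L S)
    {π : List (Literal L S V)} (hπ : ∀ l ∈ π, ¬ l.1.IsCall) :
    instConj E π = instConj E' π := by
  induction π with
  | nil => rfl
  | cons l π ih =>
    have h := ih fun l' hl' => hπ l' (List.mem_cons_of_mem _ hl')
    unfold instConj at h ⊢
    rw [List.foldr_cons, List.foldr_cons, h,
      Literal.inst_congr_of_not_isCall E E' (hπ l List.mem_cons_self)]

end QuantifierFree

namespace Program

variable {L : FirstOrder.Language.{u, v}} {A : Program L}

theorem mem_paths {P : A.Proc} {π : List (Literal L A.toProcSig (A.Vars P))} :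
    π ∈ A.paths P ↔ IsPrimeImplicant (A.body P) π := by
  simp [paths]

theorem call_pos_of_mem_paths {P : A.Proc} {π : List (Literal L A.toProcSig (A.Vars P))}
    (hπ : π ∈ A.paths P) : ∀ l ∈ π, l.1.IsCall → l.2 = true :=
  fun _ hl hc => (mem_paths.1 hπ).call_pos (A.body_positive P) hl hc

section

variable {M : Type*} [L.Structure M]

theorem body_realize_of_path {P : A.Proc} {π : List (Literal L A.toProcSig (A.Vars P))}
    (hπ : π ∈ A.paths P) {X : Interp A.toProcSig M} {x : A.Vars P → M}
    (hx : ConjRealize X x π) : (A.body P).Realize X x :=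
  (mem_paths.1 hπ).2.1 _ hx

theorem exists_path_of_body_realize {P : A.Proc} {X : Interp A.toProcSig M} {x : A.Vars P → M}
    (hx : (A.body P).Realize X x) : ∃ π ∈ A.paths P, ConjRealize X x π := by
  obtain ⟨π, h, h'⟩ := exists_primeImplicant hx
  exact ⟨π, mem_paths.2 h, h'⟩

/-! ### The interpretations defined by assertion maps -/

theorem mem_underEnv {m : A.AMap} {b : ℕ} {P : A.Proc} {y : A.Formals P → M} :
    y ∈ (underEnv m b).interp M P ↔
      ∃ δ b', b' ≤ b ∧ (⟨P, δ, b'⟩ : A.Triple) ∈ m ∧ δ.Realize y := by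
  have := m.finite_fmls P (· ≤ b)
  refine Formula.realize_iSup.trans ?_
  simp only [Subtype.exists]
  constructor
  · rintro ⟨δ, ⟨b', hb', h⟩, hy⟩
    exact ⟨δ, b', hb', h, hy⟩
  · rintro ⟨δ, b', hb', h, hy⟩
    exact ⟨δ, ⟨b', hb', h⟩, hy⟩

theorem mem_overEnv {m : A.AMap} {b : ℕ} {P : A.Proc} {y : A.Formals P → M} :
    y ∈ (overEnv m b).interp M P ↔
      ∀ δ b', b ≤ b' → (⟨P, δ, b'⟩ : A.Triple) ∈ m → δ.Realize y := by
  have := m.finite_fmls P (b ≤ ·)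
  refine Formula.realize_iInf.trans ?_
  simp only [Subtype.forall]
  constructor
  · intro H δ b' hb' h
    exact H δ ⟨b', hb', h⟩
  · rintro H δ ⟨b', hb', h⟩
    exact H δ b' hb' h

theorem underEnv_mono {m m' : A.AMap} {b b' : ℕ} (h : m ⊆ m') (hb : b ≤ b') (P : A.Proc) :
    (underEnv m b).interp M P ⊆ (underEnv m' b').interp M P := by
  intro y hy
  obtain ⟨δ, c, hc, hδ, hr⟩ := mem_underEnv.1 hy
  exact mem_underEnv.2 ⟨δ, c, hc.trans hb, h hδ, hr⟩

theorem overEnv_anti {m m' : A.AMap} {b b' : ℕ} (h : m ⊆ m') (hb : b ≤ b') (P : A.Proc) :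
    (overEnv m' b).interp M P ⊆ (overEnv m b').interp M P :=
  fun _ hy => mem_overEnv.2 fun δ c hc hδ => mem_overEnv.1 hy δ c (hb.trans hc) (h hδ)

theorem realize_reachFact {ρ : A.AMap} {P : A.Proc} {b : ℕ}
    {π : List (Literal L A.toProcSig (A.Vars P))} {x : A.Formals P → M} :
    (reachFact ρ P b π).Realize x ↔
      ∃ y : A.Locals P → M, ConjRealize ((underEnvPred ρ b).interp M) (Sum.elim x y) π := by
  unfold reachFact
  rw [Formula.realize_iExs]
  simp only [realize_instConj]

theorem realize_callQuery {P R : A.Proc} {a : A.Formals R → L.Term (A.Vars P)}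
    {θ : L.Formula (A.Vars P)} {z : A.Formals R → M} :
    (callQuery R a θ).Realize z ↔
      ∃ x : A.Vars P → M, θ.Realize x ∧ z = fun i => (a i).realize x := by
  unfold callQuery
  rw [Formula.realize_iExs]
  simp [Formula.realize_relabel, funext_iff]

theorem realize_relabel_inl {P : A.Proc} {χ : L.Formula (A.Formals P)} {x : A.Vars P → M} :
    (χ.relabel (Sum.inl : A.Formals P → A.Vars P)).Realize x ↔ χ.Realize (x ∘ Sum.inl) :=
  Formula.realize_relabel

end

/-! ### Dependence of environments and facts on lower bounds -/

/-- Equality of formulas, not mere equivalence, is needed in the end: `ReachEvent.Known` tests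
whether a formula is an element of `ρ`. -/
theorem iSup_subtype_congr {V : Type} {p p' : L.Formula V → Prop} (h : p = p')
    [Finite {δ // p δ}] [Finite {δ // p' δ}] :
    Formula.iSup (fun δ : {δ // p δ} => δ.1) = Formula.iSup (fun δ : {δ // p' δ} => δ.1) := by
  subst h
  rfl

/-- `U_m^b` depends only on the facts at bounds at most `b`. -/
theorem underEnv_congr {m m' : A.AMap} {b : ℕ}
    (h : ∀ t : A.Triple, t.bound ≤ b → (t ∈ m ↔ t ∈ m')) : underEnv m b = underEnv m' b := by
  funext P
  have := m.finite_fmls P (· ≤ b)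
  have := m'.finite_fmls P (· ≤ b)
  refine iSup_subtype_congr ?_
  funext δ
  exact propext (exists_congr fun b' => and_congr_right fun hb' => h _ hb')

/-- Reachability facts at bound `b` depend only on the facts at bounds below `b`. -/
theorem reachFact_congr {ρ ρ' : A.AMap} {b : ℕ}
    (h : ∀ t : A.Triple, t.bound < b → (t ∈ ρ ↔ t ∈ ρ')) (P : A.Proc)
    (π : List (Literal L A.toProcSig (A.Vars P))) : reachFact ρ P b π = reachFact ρ' P b π := by
  have : underEnvPred ρ b = underEnvPred ρ' b := by
    cases b with
    | zero => rfl
    | succ b => exact underEnv_congr fun t ht => h t (Nat.lt_succ_of_le ht)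
  unfold reachFact
  rw [this]

theorem reachFact_congr_of_no_call {ρ ρ' : A.AMap} {P : A.Proc} {b : ℕ}
    {π : List (Literal L A.toProcSig (A.Vars P))} (hπ : ∀ l ∈ π, ¬ l.1.IsCall) :
    reachFact ρ P b π = reachFact ρ' P b π := by
  unfold reachFact
  rw [instConj_congr_of_no_call (underEnvPred ρ b) (underEnvPred ρ' b) hπ]

end Program

end RecMC

/-! ### Answered queries -/

namespace RecMC

open FirstOrder FirstOrder.Language

namespace Program

variable {L : FirstOrder.Language.{u, v}} {A : Program L}

/-- The known reachability facts do not meet the query. -/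
def Unreached (T : L.Theory) (ρ : A.AMap) (q : A.Triple) : Prop :=
  ∀ (I : Theory.ModelType.{u, v, max u v} T) (x : A.Formals q.proc → I),
    x ∈ (underEnv ρ q.bound).interp I q.proc → ¬ q.fml.Realize x

/-- The known summary facts exclude the query. -/
def Blocked (T : L.Theory) (σ : A.AMap) (q : A.Triple) : Prop :=
  ∀ (I : Theory.ModelType.{u, v, max u v} T) (x : A.Formals q.proc → I),
    x ∈ (overEnv σ q.bound).interp I q.proc → ¬ q.fml.Realize x

/-- The query has a negative or a positive answer. -/
def Answered (T : L.Theory) (ρ σ : A.AMap) (q : A.Triple) : Prop :=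
  Blocked T σ q ∨ ¬ Unreached T ρ q

theorem Unreached.anti {T : L.Theory} {ρ ρ' : A.AMap} (h : ρ ⊆ ρ') {q : A.Triple}
    (hq : Unreached T ρ' q) : Unreached T ρ q :=
  fun I x hx => hq I x (underEnv_mono h le_rfl _ hx)

theorem Blocked.mono {T : L.Theory} {σ σ' : A.AMap} (h : σ ⊆ σ') {q : A.Triple}
    (hq : Blocked T σ q) : Blocked T σ' q :=
  fun I x hx => hq I x (overEnv_anti h le_rfl _ hx)

theorem Answered.mono {T : L.Theory} {ρ ρ' σ σ' : A.AMap} (hρ : ρ ⊆ ρ') (hσ : σ ⊆ σ')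
    {q : A.Triple} (hq : Answered T ρ σ q) : Answered T ρ' σ' q :=
  hq.imp (Blocked.mono hσ) fun h h' => h (h'.anti hρ)

section Steps

variable {T : L.Theory} {ρ σ : A.AMap} {P : A.Proc} {b : ℕ}

open Classical in
theorem blocked_insert_of_models {ψ η : L.Formula (A.Formals P)} {c : ℕ} (hc : c ≤ b)
    (h : T ⊨ᵇ (overEnv σ c P ⊓ ψ).imp (∼η)) :
    Blocked T (insert (⟨P, ψ, b⟩ : A.Triple) σ) ⟨P, η, c⟩ := by
  intro I x hx
  rw [models_imp_not_iff] at h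
  refine h I x (Formula.realize_inf.2 ⟨?_, ?_⟩)
  · exact overEnv_anti (Finset.subset_insert _ _) le_rfl P hx
  · exact mem_overEnv.1 hx ψ b hc (Finset.mem_insert_self _ _)

open Classical in
theorem not_unreached_insert_of_not_models {ψ η : L.Formula (A.Formals P)} {c : ℕ} (hc : b ≤ c)
    (h : ¬ T ⊨ᵇ ψ.imp (∼η)) :
    ¬ Unreached T (insert (⟨P, ψ, b⟩ : A.Triple) ρ) ⟨P, η, c⟩ := by
  obtain ⟨I, x, hψ, hη⟩ := not_models_imp_not_iff.1 h
  exact fun hu => hu I x (mem_underEnv.2 ⟨ψ, b, hc, Finset.mem_insert_self _ _, hψ⟩) hη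

open Classical in
-- This is why `Reach` must discard every query at a bound at least `b` that the new fact meets: the
-- remaining queries stay unreached.
theorem unreached_insert {ψ : L.Formula (A.Formals P)} {q : A.Triple} (hq : Unreached T ρ q)
    (h : ∀ η c, q = ⟨P, η, c⟩ → b ≤ c → T ⊨ᵇ ψ.imp (∼η)) :
    Unreached T (insert (⟨P, ψ, b⟩ : A.Triple) ρ) q := by
  intro I x hx
  obtain ⟨δ, b', hb', hδ, hr⟩ := mem_underEnv.1 hx
  rcases Finset.mem_insert.1 hδ with he | hδ
  · obtain ⟨R, η, c⟩ := q
    cases he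
    exact models_imp_not_iff.1 (h η c rfl hb') I x hr
  · exact hq I x (mem_underEnv.2 ⟨δ, b', hb', hδ, hr⟩)

/-- The query does not mention the locals, so their quantifier can be moved out of the implication.
-/
theorem not_models_reachFact_iff {π : List (Literal L A.toProcSig (A.Vars P))}
    {η : L.Formula (A.Formals P)} :
    (¬ T ⊨ᵇ (reachFact ρ P b π).imp (∼η)) ↔
      ¬ T ⊨ᵇ (instConj (underEnvPred ρ b) π).imp
        (∼(η.relabel (Sum.inl : A.Formals P → A.Vars P))) := by
  rw [not_models_imp_not_iff, not_models_imp_not_iff]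
  simp only [realize_reachFact, realize_instConj, realize_relabel_inl]
  constructor
  · rintro ⟨I, x, ⟨y, hy⟩, hx⟩
    exact ⟨I, Sum.elim x y, hy, by simpa using hx⟩
  · rintro ⟨I, x, hπ, hx⟩
    exact ⟨I, x ∘ Sum.inl, ⟨x ∘ Sum.inr, by simpa using hπ⟩, hx⟩

end Steps

section QueryStep

variable {T : L.Theory} {ρ σ : A.AMap} {P R : A.Proc} {b : ℕ} {χ : L.Formula (A.Formals P)}
  {πu πv : List (Literal L A.toProcSig (A.Vars P))} {a : A.Formals R → L.Term (A.Vars P)}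

/-- The formula of the query that `Query` derives from a decomposition of a path. -/
noncomputable def childFml (ρ σ : A.AMap) (χ : L.Formula (A.Formals P)) (b : ℕ)
    (πu πv : List (Literal L A.toProcSig (A.Vars P)))
    (a : A.Formals R → L.Term (A.Vars P)) : L.Formula (A.Formals R) :=
  callQuery R a (instConj (overEnv σ b) πu ⊓ instConj (underEnv ρ b) πv ⊓ χ.relabel Sum.inl)

theorem realize_childFml {M : Type*} [L.Structure M] {z : A.Formals R → M} :
    (childFml ρ σ χ b πu πv a).Realize z ↔ ∃ x : A.Vars P → M,
      ConjRealize ((overEnv σ b).interp M) x πu ∧ ConjRealize ((underEnv ρ b).interp M) x πv ∧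
        χ.Realize (x ∘ Sum.inl) ∧ z = fun i => (a i).realize x := by
  unfold childFml
  rw [realize_callQuery]
  simp only [Formula.realize_inf, realize_instConj, realize_relabel_inl, and_assoc]

/-- The child query describes exactly the argument tuples of the call for which the rest of the path
and `χ` hold. Together with `over_allows_iff`, the side conditions of `Query` thus say that the
child is still unanswered. -/
theorem under_blocks_iff :
    T ⊨ᵇ (instConj (overEnv σ b) πu ⊓ (Atom.call R a).inst (underEnv ρ b) ⊓
        instConj (underEnv ρ b) πv).imp (∼(χ.relabel (Sum.inl : A.Formals P → A.Vars P))) ↔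
      Unreached T ρ ⟨R, childFml ρ σ χ b πu πv a, b⟩ := by
  rw [models_imp_not_iff]
  simp only [Unreached, Formula.realize_inf, realize_instConj, realize_relabel_inl,
    Atom.realize_inst, realize_childFml, Atom.Realize]
  constructor
  · rintro h I _ hz ⟨x, hu, hv, hχ, rfl⟩
    exact h I x ⟨⟨hu, hz⟩, hv⟩ hχ
  · rintro h I x ⟨⟨hu, hz⟩, hv⟩ hχ
    exact h I _ hz ⟨x, hu, hv, hχ, rfl⟩

theorem over_allows_iff :
    ¬ T ⊨ᵇ (instConj (overEnv σ b) πu ⊓ (Atom.call R a).inst (overEnv σ b) ⊓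
        instConj (underEnv ρ b) πv).imp (∼(χ.relabel (Sum.inl : A.Formals P → A.Vars P))) ↔
      ¬ Blocked T σ ⟨R, childFml ρ σ χ b πu πv a, b⟩ := by
  rw [models_imp_not_iff, not_iff_not]
  simp only [Blocked, Formula.realize_inf, realize_instConj, realize_relabel_inl,
    Atom.realize_inst, realize_childFml, Atom.Realize]
  constructor
  · rintro h I _ hz ⟨x, hu, hv, hχ, rfl⟩
    exact h I x ⟨⟨hu, hz⟩, hv⟩ hχ
  · rintro h I x ⟨⟨hu, hz⟩, hv⟩ hχ
    exact h I _ hz ⟨x, hu, hv, hχ, rfl⟩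

end QueryStep

/-! ### Deadlock freedom -/

/-- Some instantiation of a path changes from unsatisfiable to satisfiable at a call when the
under-approximations are replaced, from left to right, by over-approximations. -/
theorem exists_switching_call {P : A.Proc} (good : List (Literal L A.toProcSig (A.Vars P)) →
      List (Literal L A.toProcSig (A.Vars P)) → Prop)
    (hmove : ∀ πu l πv, ¬ l.1.IsCall → good (πu ++ [l]) πv → good πu (l :: πv)) :
    ∀ π π₀, ¬ good π₀ π → good (π₀ ++ π) [] → ∃ πu l πv, π₀ ++ π = πu ++ l :: πv ∧
      l.1.IsCall ∧ ¬ good πu (l :: πv) ∧ good (πu ++ [l]) πv := by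
  intro π
  induction π with
  | nil => intro π₀ h h'; exact absurd (by simpa using h') h
  | cons l π ih =>
    intro π₀ h h'
    by_cases hg : good (π₀ ++ [l]) π
    · refine ⟨π₀, l, π, rfl, ?_, h, hg⟩
      by_contra hl
      exact h (hmove _ _ _ hl hg)
    · obtain ⟨πu, l', πv, he, hr⟩ := ih (π₀ ++ [l]) hg (by simpa using h')
      exact ⟨πu, l', πv, by simpa using he, hr⟩

theorem exists_step_of_mem {T : L.Theory} {φ : L.Formula (A.Formals A.main)} {n : ℕ}
    {Q : Set A.Triple} (ρ σ : A.AMap) {q : A.Triple} (hq : q ∈ Q) :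
    ∃ s', BndStep T φ n (.running Q ρ σ) s' := by
  -- At the least bound no query is open one level below, so the non-overlap condition of `Query`
  -- holds vacuously.
  obtain ⟨q, hq, hmin⟩ : ∃ q ∈ Q, ∀ q' ∈ Q, q.bound ≤ q'.bound := by
    have hne : (Triple.bound '' Q).Nonempty := ⟨_, q, hq, rfl⟩
    obtain ⟨q₀, hq₀, he⟩ := Nat.sInf_mem hne
    exact ⟨q₀, hq₀, fun q' hq' => he ▸ Nat.sInf_le ⟨q', hq', rfl⟩⟩
  obtain ⟨P, χ, b⟩ := q
  by_cases hsum : T ⊨ᵇ ((A.body P).inst (overEnvPred σ b)).imp (∼(χ.relabel Sum.inl))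
  -- The negated query itself is the weakest possible interpolant.
  · refine ⟨_, _, Step.sum Q ρ σ P χ b (∼χ) hq hsum ?_ ?_⟩
    · rw [models_imp_not_iff] at hsum
      rw [models_imp_iff]
      intro I x hx
      rw [realize_relabel_inl, Formula.realize_not, ← realize_relabel_inl]
      exact hsum I x hx
    · rw [models_imp_iff]
      exact fun I x hx => hx
  by_cases hreach : ∃ π ∈ A.paths P,
      ¬ T ⊨ᵇ (instConj (underEnvPred ρ b) π).imp (∼(χ.relabel Sum.inl))
  · obtain ⟨π, hπ, hf⟩ := hreach
    exact ⟨_, _, Step.reach Q ρ σ P χ b π hq hπ hf⟩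
  push Not at hreach
  obtain ⟨I, x, hbody, hχ⟩ := not_models_imp_not_iff.1 hsum
  rw [QF.realize_inst] at hbody
  obtain ⟨π, hπ, hπx⟩ := exists_path_of_body_realize hbody
  cases b with
  -- At bound 0 both environments map every symbol to `⊥`, so a path feasible for `σ` is feasible
  -- for `ρ`.
  | zero =>
    exact absurd hχ (models_imp_not_iff.1 (hreach π hπ) I x ((realize_instConj _ _ _).2 hπx))
  | succ b =>
    -- Satisfiability of a path split in two: calls in the first part are over-approximated, those
    -- in the second under-approximated.
    let good : List (Literal L A.toProcSig (A.Vars P)) →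
        List (Literal L A.toProcSig (A.Vars P)) → Prop := fun πu πv =>
      ∃ (I : Theory.ModelType.{u, v, max u v} T) (x : A.Vars P → I),
        ConjRealize ((overEnv σ b).interp I) x πu ∧ ConjRealize ((underEnv ρ b).interp I) x πv ∧
          χ.Realize (x ∘ Sum.inl)
    obtain ⟨πu, l, πv, he, hcall, hno, hyes⟩ := exists_switching_call good
      (by
        rintro πu l πv hl ⟨I, x, hu, hv, hχ⟩
        rw [conjRealize_append, conjRealize_cons] at hu
        refine ⟨I, x, hu.1, ?_, hχ⟩
        rw [conjRealize_cons]
        refine ⟨?_, hv⟩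
        have := hu.2.1
        unfold Literal.eval at this ⊢
        rwa [Atom.realize_congr_of_not_isCall (Y := (underEnv ρ b).interp I) x hl] at this)
      π []
      (by
        rintro ⟨I, x, -, hv, hχ⟩
        exact models_imp_not_iff.1 (hreach π hπ) I x ((realize_instConj _ _ _).2 hv)
          (realize_relabel_inl.2 hχ))
      ⟨I, x, hπx, by simp, realize_relabel_inl.1 hχ⟩
    rw [List.nil_append] at he
    have hpos := call_pos_of_mem_paths hπ l (by simp [he]) hcall
    obtain ⟨atm, s⟩ := l
    obtain rfl : s = true := hpos
    cases atm with
    | eq t₁ t₂ => exact absurd hcall id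
    | rel S ts => exact absurd hcall id
    | call R a =>
      refine ⟨_, _, Step.query Q ρ σ P χ b πu πv R a _ hq ?_ (he ▸ hπ) ?_ ?_ rfl ?_⟩
      · rw [models_imp_not_iff]
        intro I x hx hχ
        rw [QF.realize_inst] at hx
        obtain ⟨π', hπ', hx'⟩ := exists_path_of_body_realize hx
        exact models_imp_not_iff.1 (hreach π' hπ') I x ((realize_instConj _ _ _).2 hx') hχ
      · rw [models_imp_not_iff]
        simp only [Formula.realize_inf, realize_instConj, realize_relabel_inl, Atom.realize_inst]
        rintro I x ⟨⟨hu, hz⟩, hv⟩ hχ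
        exact hno ⟨I, x, hu, by simpa [Literal.eval] using ⟨hz, hv⟩, hχ⟩
      · rw [not_models_imp_not_iff]
        simp only [Formula.realize_inf, realize_instConj, realize_relabel_inl, Atom.realize_inst]
        obtain ⟨I, x, hu, hv, hχ⟩ := hyes
        rw [conjRealize_append, conjRealize_cons] at hu
        exact ⟨I, x, ⟨⟨hu.1, by simpa [Literal.eval] using hu.2.1⟩, hv⟩, hχ⟩
      · intro η hη
        have := hmin _ hη
        simp at this

end Program

end RecMC

/-! ### Properties of single rule applications -/

namespace RecMC

open FirstOrder FirstOrder.Language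

namespace Program

variable {L : FirstOrder.Language.{u, v}} {A : Program L} {T : L.Theory}
  {φ : L.Formula (A.Formals A.main)} {n : ℕ} {Q Q' : Set A.Triple} {ρ ρ' σ σ' : A.AMap}
  {r : A.RuleApp}

theorem Step.under_subset (h : Step T φ n (.running Q ρ σ) r (.running Q' ρ' σ')) : ρ ⊆ ρ' := by
  classical
  cases h with
  | reach => convert Finset.subset_insert _ _
  | _ => rfl

theorem Step.over_subset (h : Step T φ n (.running Q ρ σ) r (.running Q' ρ' σ')) : σ ⊆ σ' := by
  classical
  cases h with
  | sum => convert Finset.subset_insert _ _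
  | _ => rfl

theorem Step.unreached (h : Step T φ n (.running Q ρ σ) r (.running Q' ρ' σ'))
    (hQ : ∀ q ∈ Q, Unreached T ρ q) : ∀ q ∈ Q', Unreached T ρ' q := by
  cases h with
  | sum => exact fun q hq => hQ q hq.1
  | reach _ _ _ P χ b π =>
    intro q hq
    refine unreached_insert (hQ q hq.1) fun η c he hc => ?_
    by_contra hcon
    exact hq.2 ⟨η, c, he, hc, hcon⟩
  | query _ _ _ P χ b πu πv R a ψ mem unreached path under_blocks over_allows new_query =>
    rintro q (hq | rfl)
    · exact hQ q hq
    · rw [new_query]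
      exact under_blocks_iff.1 under_blocks

theorem Step.answered (h : Step T φ n (.running Q ρ σ) r (.running Q' ρ' σ')) {q : A.Triple}
    (hq : q ∈ Q) (hq' : q ∉ Q') : Answered T ρ' σ' q := by
  cases h with
  | sum _ _ _ P χ b ψ =>
    obtain ⟨η, c, rfl, hc, hm⟩ := not_not.1 fun hn => hq' ⟨hq, hn⟩
    exact Or.inl (blocked_insert_of_models hc hm)
  | reach _ _ _ P χ b π =>
    obtain ⟨η, c, rfl, hc, hm⟩ := not_not.1 fun hn => hq' ⟨hq, hn⟩
    exact Or.inr (not_unreached_insert_of_not_models hc hm)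
  | query => exact absurd (Or.inl hq) hq'

theorem Step.mem_or_not_answered (h : Step T φ n (.running Q ρ σ) r (.running Q' ρ' σ'))
    {q : A.Triple} (hq : q ∈ Q') : q ∈ Q ∨ ¬ Answered T ρ' σ' q := by
  cases h with
  | sum => exact Or.inl hq.1
  | reach => exact Or.inl hq.1
  | query _ _ _ P χ b πu πv R a ψ mem unreached path under_blocks over_allows new_query =>
    rcases hq with hq | rfl
    · exact Or.inl hq
    · subst new_query
      exact Or.inr (not_or.2 ⟨over_allows_iff.1 over_allows,
        not_not.2 (under_blocks_iff.1 under_blocks)⟩)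

theorem Step.mem_or_created (h : Step T φ n (.running Q ρ σ) r (.running Q' ρ' σ'))
    {q : A.Triple} (hq : q ∈ Q') : q ∈ Q ∨ ∃ q₀, r = .query q₀ q := by
  cases h with
  | sum => exact Or.inl hq.1
  | reach => exact Or.inl hq.1
  | query =>
    rcases hq with hq | rfl
    · exact Or.inl hq
    · exact Or.inr ⟨_, rfl⟩

/-- `Sum` and `Reach` answer the query to which they are applied. -/
theorem Step.answers (h : Step T φ n (.running Q ρ σ) r (.running Q' ρ' σ')) {q : A.Triple}
    (hr : r = .sum q ∨ r = .reach q) : q ∈ Q ∧ q ∉ Q' := by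
  cases h with
  | sum _ _ _ P χ b ψ mem blocked itp_left itp_right =>
    obtain rfl : (⟨P, χ, b⟩ : A.Triple) = q := by simpa using hr
    refine ⟨mem, fun hn => hn.2 ⟨χ, b, rfl, le_rfl, ?_⟩⟩
    rw [models_imp_not_iff] at itp_right ⊢
    exact fun I x hx => itp_right I x (Formula.realize_inf.1 hx).2
  | reach _ _ _ P χ b π mem path feasible =>
    obtain rfl : (⟨P, χ, b⟩ : A.Triple) = q := by simpa using hr
    exact ⟨mem, fun hn => hn.2 ⟨χ, b, rfl, le_rfl, not_models_reachFact_iff.2 feasible⟩⟩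
  | query => simp at hr

theorem Step.bound_of_query {q q' : A.Triple} {s s' : A.State}
    (h : Step T φ n s (.query q q') s') :
    q.bound = q'.bound + 1 := by
  cases h
  rfl

theorem Step.mem_of_on {s' : A.State} (h : Step T φ n (.running Q ρ σ) r s') {q : A.Triple}
    (hr : r.On q) : q ∈ Q := by
  cases h with
  | sum _ _ _ P χ b ψ mem => exact hr ▸ mem
  | reach _ _ _ P χ b π mem => exact hr ▸ mem
  | query _ _ _ P χ b πu πv R a ψ mem => exact hr ▸ mem
  | resUnsafe => exact hr.elim
  | resSafe => exact hr.elim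

theorem Step.exists_on (h : Step T φ n (.running Q ρ σ) r (.running Q' ρ' σ')) :
    ∃ q ∈ Q, r.On q := by
  cases h with
  | sum _ _ _ P χ b ψ mem => exact ⟨_, mem, rfl⟩
  | reach _ _ _ P χ b π mem => exact ⟨_, mem, rfl⟩
  | query _ _ _ P χ b πu πv R a ψ mem => exact ⟨_, mem, rfl⟩

/-! ### Accounting of rule applications -/

variable (A) in
/-- An application of `Reach` to a path at a bound. -/
structure ReachEvent where
  proc : A.Proc
  path : List (Literal L A.toProcSig (A.Vars proc))
  bound : ℕ

variable (A) in
/-- An application of `Query` to a query at a position of a path. -/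
structure QueryEvent where
  query : A.Triple
  path : List (Literal L A.toProcSig (A.Vars query.proc))
  pos : ℕ

/-- The number of applications of `Reach` at bounds below `b`. -/
def reachesBelow (rl : List A.ReachEvent) (b : ℕ) : ℕ :=
  rl.countP fun e => decide (e.bound < b)

/-- The reachability fact of the event, inferred from the current facts, is known. -/
def ReachEvent.Known (ρ : A.AMap) (e : A.ReachEvent) : Prop :=
  (⟨e.proc, reachFact ρ e.proc e.bound e.path, e.bound⟩ : A.Triple) ∈ ρ

/-- The query that `Query` would create at the position is contained in an open query or in one
that has a negative answer, so that the rule is disabled. -/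
def QueryEvent.Exhausted (T : L.Theory) (Q : Set A.Triple) (ρ σ : A.AMap) (e : A.QueryEvent) :
    Prop :=
  ∃ (πu πv : List (Literal L A.toProcSig (A.Vars e.query.proc))) (R : A.Proc)
    (a : A.Formals R → L.Term (A.Vars e.query.proc)) (b : ℕ) (ψ : L.Formula (A.Formals R)),
    e.path ∈ A.paths e.query.proc ∧ e.path = πu ++ (Atom.call R a, true) :: πv ∧
      πu.length = e.pos ∧ e.query.bound = b + 1 ∧
      ((⟨R, ψ, b⟩ : A.Triple) ∈ Q ∨ Blocked T σ ⟨R, ψ, b⟩) ∧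
      ∀ (I : Theory.ModelType.{u, v, max u v} T) (z : A.Formals R → I),
        (childFml ρ σ e.query.fml b πu πv a).Realize z → ψ.Realize z

open Classical in
/-- The bookkeeping invariant of a run that has applied the rules `rs`.  The lists `rl` and `ql`
record the paths used by `Reach` and `Query`; `fresh` says that the run started without
reachability facts. -/
structure Accounting (T : L.Theory) (fresh : Prop) (rs : List A.RuleApp) (rl : List A.ReachEvent)
    (ql : List A.QueryEvent) (Q : Set A.Triple) (ρ σ : A.AMap) : Prop where
  unreached : ∀ q ∈ Q, Unreached T ρ q
  reach_path : ∀ e ∈ rl, e.path ∈ A.paths e.proc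
  numReach_eq : ∀ P b,
    numReach rs P b = rl.countP fun e => decide (e.proc = P ∧ e.bound ≤ b)
  reach_count : ∀ e, (rl.countP fun e' => decide (e' = e)) ≤
    reachesBelow rl e.bound + if e.Known ρ then 1 else 0
  reach_count_of_no_call : ∀ e, (∀ l ∈ e.path, ¬ l.1.IsCall) →
    (rl.countP fun e' => decide (e' = e)) ≤ if e.Known ρ then 1 else 0
  fresh_fact : fresh → ∀ t ∈ ρ, ∃ e ∈ rl, e.bound = t.bound
  fresh_reach_count : fresh → ∀ e, (∃ l ∈ e.path, l.1.IsCall) →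
    (rl.countP fun e' => decide (e' = e)) = 0 ∨
      (rl.countP fun e' => decide (e' = e)) + 1 ≤
        reachesBelow rl e.bound + if e.Known ρ then 1 else 0
  query_path : ∀ e ∈ ql, e.path ∈ A.paths e.query.proc ∧
    ∃ l, e.path[e.pos]? = some l ∧ l.1.IsCall
  numQuery_eq : ∀ q, numQuery rs q = ql.countP fun e => decide (e.query = q)
  query_count : ∀ e, (ql.countP fun e' => decide (e' = e)) ≤
    reachesBelow rl e.query.bound + if e.Exhausted T Q ρ σ then 1 else 0
  answer_count : ∀ q, (rs.countP fun r => decide (r = .sum q ∨ r = .reach q)) ≤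
    if q ∉ Q ∧ Answered T ρ σ q then 1 else 0
  query_bound : ∀ q q', RuleApp.query q q' ∈ rs → q.bound = q'.bound + 1

theorem Accounting.initial {fresh : Prop} (hfresh : fresh → ρ = ∅)
    (hQ : ∀ q ∈ Q, Unreached T ρ q) : Accounting T fresh [] [] [] Q ρ σ where
  unreached := hQ
  reach_path := by simp
  numReach_eq := by simp [numReach]
  reach_count := by simp
  reach_count_of_no_call := by simp
  fresh_fact h t ht := by simp [hfresh h] at ht
  fresh_reach_count := by simp
  query_path := by simp
  numQuery_eq := by simp [numQuery]
  query_count := by simp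
  answer_count := by simp
  query_bound := by simp

section

variable {fresh : Prop} {rs : List A.RuleApp} {rl : List A.ReachEvent} {ql : List A.QueryEvent}

open Classical in
-- `Sum` and `Reach` remove the query to which they are applied; being answered is preserved, and
-- only unanswered queries enter the set. So each query is answered directly at most once.
theorem Accounting.answer_count_step (H : Accounting T fresh rs rl ql Q ρ σ)
    (h : Step T φ n (.running Q ρ σ) r (.running Q' ρ' σ')) (q : A.Triple) :
    ((rs ++ [r]).countP fun r => decide (r = .sum q ∨ r = .reach q)) ≤
      if q ∉ Q' ∧ Answered T ρ' σ' q then 1 else 0 := by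
  rw [List.countP_append, List.countP_singleton]
  have h₀ := H.answer_count q
  by_cases hr : r = .sum q ∨ r = .reach q
  · obtain ⟨hq, hq'⟩ := h.answers hr
    rw [if_neg fun h => h.1 hq] at h₀
    rw [if_pos (by simpa using hr), if_pos ⟨hq', h.answered hq hq'⟩]
    omega
  · rw [if_neg (by simpa using hr), add_zero]
    refine h₀.trans ?_
    split_ifs with h₁ h₂
    · exact le_rfl
    · exfalso
      have ha := h₁.2.mono h.under_subset h.over_subset
      refine h₂ ⟨fun hq => ?_, ha⟩
      rcases h.mem_or_not_answered hq with hq | hq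
      · exact h₁.1 hq
      · exact hq ha
    · exact Nat.zero_le _
    · exact le_rfl

theorem Accounting.query_bound_step (H : Accounting T fresh rs rl ql Q ρ σ) {s s' : A.State}
    (h : Step T φ n s r s') :
    ∀ q q', RuleApp.query q q' ∈ rs ++ [r] → q.bound = q'.bound + 1 := by
  intro q q' hm
  rcases List.mem_append.1 hm with hm | hm
  · exact H.query_bound q q' hm
  · rw [List.mem_singleton] at hm
    subst hm
    exact h.bound_of_query

/-- A larger `σ` shrinks the over-approximations, and calls on paths are positive, so the prefix
only gets stronger. With the suffix unchanged, the current child query still implies the old one. -/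
theorem QueryEvent.Exhausted.mono {e : A.QueryEvent} (he : e.Exhausted T Q ρ σ)
    (hσ : σ ⊆ σ') (hρ : ∀ b, e.query.bound = b + 1 → underEnv ρ' b = underEnv ρ b)
    (hQ : ∀ q : A.Triple, e.query.bound = q.bound + 1 → q ∈ Q → q ∈ Q' ∨ Blocked T σ' q) :
    e.Exhausted T Q' ρ' σ' := by
  obtain ⟨πu, πv, R, a, b, ψ, hpath, hp, hl, hb, hm, hi⟩ := he
  refine ⟨πu, πv, R, a, b, ψ, hpath, hp, hl, hb, ?_, fun I z hz => hi I z ?_⟩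
  · rcases hm with hm | hm
    · exact hQ _ hb hm
    · exact Or.inr (hm.mono hσ)
  · rw [realize_childFml] at hz ⊢
    rw [hρ b hb] at hz
    obtain ⟨x, hu, hv⟩ := hz
    refine ⟨x, conjRealize_mono (overEnv_anti hσ le_rfl) (fun l hl' => ?_) hu, hv⟩
    exact call_pos_of_mem_paths hpath l (by rw [hp]; simp [hl'])

theorem Accounting.sum_step (H : Accounting T fresh rs rl ql Q ρ σ) {q : A.Triple}
    (h : Step T φ n (.running Q ρ σ) (.sum q) (.running Q' ρ' σ')) :
    Accounting T fresh (rs ++ [.sum q]) rl ql Q' ρ' σ' := by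
  have hun := h.unreached H.unreached
  have hac := H.answer_count_step h
  have hqb := H.query_bound_step h
  have hσ := h.over_subset
  have hrem : ∀ q' ∈ Q, q' ∈ Q' ∨ Answered T ρ' σ' q' := fun q' hq' =>
    or_iff_not_imp_left.2 (h.answered hq')
  obtain rfl : ρ' = ρ := by cases h; rfl
  exact
    { unreached := hun
      reach_path := H.reach_path
      numReach_eq := fun P b => by
        rw [← H.numReach_eq]
        simp [numReach, List.countP_append]
      reach_count := H.reach_count
      reach_count_of_no_call := H.reach_count_of_no_call
      fresh_fact := H.fresh_fact
      fresh_reach_count := H.fresh_reach_count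
      query_path := H.query_path
      numQuery_eq := fun q' => by
        rw [← H.numQuery_eq]
        simp [numQuery, List.countP_append]
      query_count := fun e => by
        refine (H.query_count e).trans (Nat.add_le_add_left ?_ _)
        split_ifs with h₁ h₂
        · exact le_rfl
        -- A child removed by `Sum` has a negative answer: it was open, hence unreached, and `ρ` has
        -- not changed.
        · refine absurd (h₁.mono hσ (fun _ _ => rfl) fun q' _ hq' => ?_) h₂
          exact (hrem q' hq').imp_right fun ha => ha.resolve_right (not_not.2 (H.unreached q' hq'))
        · exact Nat.zero_le _
        · exact le_rfl
      answer_count := hac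
      query_bound := hqb }

/-- A call on a path is positive, and under the under-approximation it can hold only through a fact
at a smaller bound. -/
theorem exists_fact_of_feasible {P : A.Proc} {b : ℕ} {χ : L.Formula (A.Formals P)}
    {π : List (Literal L A.toProcSig (A.Vars P))} (hπ : π ∈ A.paths P)
    (hf : ¬ T ⊨ᵇ (instConj (underEnvPred ρ b) π).imp
      (∼(χ.relabel (Sum.inl : A.Formals P → A.Vars P))))
    (hc : ∃ l ∈ π, l.1.IsCall) : ∃ t ∈ ρ, t.bound < b := by
  obtain ⟨⟨atm, s⟩, hl, hcall⟩ := hc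
  obtain rfl : s = true := call_pos_of_mem_paths hπ _ hl hcall
  obtain ⟨I, x, hx, -⟩ := not_models_imp_not_iff.1 hf
  have := (realize_instConj _ _ _).1 hx _ hl
  simp only [Literal.eval, if_true] at this
  cases atm with
  | eq t₁ t₂ => exact absurd hcall id
  | rel S ts => exact absurd hcall id
  | call R a =>
    cases b with
    | zero => exact absurd this id
    | succ b =>
      obtain ⟨δ, b', hb', hδ, -⟩ := mem_underEnv.1 this
      exact ⟨_, hδ, Nat.lt_succ_of_le hb'⟩

theorem reachesBelow_cons (e : A.ReachEvent) (b : ℕ) :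
    reachesBelow (e :: rl) b = reachesBelow rl b + if e.bound < b then 1 else 0 := by
  simp [reachesBelow, List.countP_cons]

/-- The new event must have been unknown before and is known afterwards. An event can lose the
status of being known only through a fact at a bound below its own, and then the right-hand side
grows by one. -/
theorem Accounting.reach_step (H : Accounting T fresh rs rl ql Q ρ σ) {q : A.Triple}
    (h : Step T φ n (.running Q ρ σ) (.reach q) (.running Q' ρ' σ')) :
    ∃ e, Accounting T fresh (rs ++ [.reach q]) (e :: rl) ql Q' ρ' σ' := by
  classical
  have hun := h.unreached H.unreached
  have hac := H.answer_count_step h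
  have hqb := H.query_bound_step h
  cases h with
  | reach _ _ _ P χ b π mem path feasible =>
  let e : A.ReachEvent := ⟨P, π, b⟩
  let ρ' : A.AMap := insert ⟨P, reachFact ρ P b π, b⟩ ρ
  -- A known fact that meets the query would contradict that open queries are unreached.
  have hunknown : ¬ e.Known ρ := by
    intro hk
    obtain ⟨I, x, hr, hχ⟩ := not_models_imp_not_iff.1 (not_models_reachFact_iff.2 feasible)
    exact H.unreached _ mem I x (mem_underEnv.2 ⟨_, b, le_rfl, hk, hr⟩) hχ
  have hmem : ∀ t : A.Triple, t.bound < b → (t ∈ ρ' ↔ t ∈ ρ) := by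
    intro t ht
    refine Finset.mem_insert.trans (or_iff_right ?_)
    rintro rfl
    exact lt_irrefl _ ht
  have hknown : ∀ e' : A.ReachEvent, e'.bound ≤ b → e'.Known ρ → e'.Known ρ' := by
    intro e' he' hk
    unfold ReachEvent.Known
    rw [reachFact_congr fun t ht => hmem t (ht.trans_le he')]
    exact Finset.mem_insert_of_mem hk
  have hknown' : e.Known ρ' := by
    unfold ReachEvent.Known
    rw [reachFact_congr (ρ' := ρ) fun t ht => hmem t ht]
    exact Finset.mem_insert_self _ _
  refine ⟨e, ?_⟩
  exact
    { unreached := hun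
      reach_path := fun e' he' => by
        rcases List.mem_cons.1 he' with rfl | he'
        · exact path
        · exact H.reach_path e' he'
      numReach_eq := fun P' b' => by
        rw [List.countP_cons, ← H.numReach_eq]
        simp [numReach, List.countP_append, List.countP_cons, e]
      reach_count := fun e' => by
        have h₀ := H.reach_count e'
        rw [List.countP_cons, reachesBelow_cons]
        by_cases he : e = e'
        · subst he
          rw [if_neg hunknown] at h₀
          rw [if_pos (by simp), if_pos hknown']
          omega
        · rw [if_neg (by simpa using he)]
          by_cases hb : b < e'.bound
          · rw [if_pos (show e.bound < e'.bound from hb)]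
            split_ifs at h₀ <;> omega
          · have := hknown e' (not_lt.1 hb)
            split_ifs at h₀ with hk
            · rw [if_pos (this hk)]
              omega
            · omega
      reach_count_of_no_call := fun e' hc => by
        have h₀ := H.reach_count_of_no_call e' hc
        rw [List.countP_cons]
        by_cases he : e = e'
        · subst he
          rw [if_neg hunknown] at h₀
          rw [if_pos (by simp), if_pos hknown']
          omega
        · rw [if_neg (by simpa using he)]
          split_ifs at h₀ with hk
          · have : e'.Known ρ' := by
              unfold ReachEvent.Known
              rw [reachFact_congr_of_no_call (ρ' := ρ) hc]
              exact Finset.mem_insert_of_mem hk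
            rw [if_pos this]
            omega
          · omega
      fresh_fact := fun hf t ht => by
        rcases Finset.mem_insert.1 ht with rfl | ht
        · exact ⟨e, List.mem_cons_self, rfl⟩
        · obtain ⟨e', he', hb⟩ := H.fresh_fact hf t ht
          exact ⟨e', List.mem_cons_of_mem _ he', hb⟩
      fresh_reach_count := fun hf e' hc => by
        have h₀ := H.fresh_reach_count hf e' hc
        rw [List.countP_cons, reachesBelow_cons]
        by_cases he : e = e'
        · subst he
          rw [if_neg hunknown] at h₀
          rw [if_pos (by simp), if_pos hknown']
          -- This covers the first application: starting from an empty `ρ`, the fact that makes the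
          -- call possible comes from an earlier `Reach` below the bound.
          have : 0 < reachesBelow rl e.bound := by
            obtain ⟨t, ht, htb⟩ := exists_fact_of_feasible path feasible hc
            obtain ⟨e', he', hb⟩ := H.fresh_fact hf t ht
            exact List.countP_pos_iff.2 ⟨e', he', by simpa [hb, e] using htb⟩
          omega
        · rw [if_neg (by simpa using he)]
          by_cases hb : b < e'.bound
          · rw [if_pos (show e.bound < e'.bound from hb)]
            split_ifs at h₀ <;> omega
          · have := hknown e' (not_lt.1 hb)
            split_ifs at h₀ with hk
            · rw [if_pos (this hk)]
              omega
            · omega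
      query_path := H.query_path
      numQuery_eq := fun q' => by
        rw [← H.numQuery_eq]
        simp [numQuery, List.countP_append]
      query_count := fun e' => by
        have h₀ := H.query_count e'
        rw [reachesBelow_cons]
        by_cases hb : b < e'.query.bound
        · rw [if_pos (show e.bound < e'.query.bound from hb)]
          split_ifs at h₀ <;> omega
        · split_ifs at h₀ with hk
          · rw [if_pos (c := QueryEvent.Exhausted _ _ _ _ _) (hk.mono subset_rfl ?_ ?_)]
            · omega
            · exact fun b' hb' => underEnv_congr fun t ht => hmem t (by omega)
            -- `Reach` at `b` removes only queries at bounds at least `b`, while the child lies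
            -- strictly below the bound of its parent, which is at most `b` here.
            · refine fun q' hq'b hq' => Or.inl ⟨hq', ?_⟩
              rintro ⟨η, c, rfl, hc, -⟩
              simp only at hq'b
              omega
          · omega
      answer_count := hac
      query_bound := hqb }

/-- An exhausted position cannot be used: some argument tuple in the new query is allowed by `σ`,
and it would lie in an old child that is open, against non-overlap, or blocked. The query just
created makes the position exhausted. -/
theorem Accounting.query_step (H : Accounting T fresh rs rl ql Q ρ σ) {q q' : A.Triple}
    (h : Step T φ n (.running Q ρ σ) (.query q q') (.running Q' ρ' σ')) :
    ∃ e, Accounting T fresh (rs ++ [.query q q']) rl (e :: ql) Q' ρ' σ' := by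
  classical
  have hun := h.unreached H.unreached
  have hac := H.answer_count_step h
  have hqb := H.query_bound_step h
  cases h with
  | query _ _ _ P χ b πu πv R a ψ mem unreached path under_blocks over_allows new_query
      no_overlap =>
  let e : A.QueryEvent := ⟨⟨P, χ, b + 1⟩, πu ++ (Atom.call R a, true) :: πv, πu.length⟩
  have hψ : ψ = childFml ρ σ χ b πu πv a := new_query
  have hnot : ¬ e.Exhausted T Q ρ σ := by
    rintro ⟨πu', πv', R', a', b', ψ', -, hp, hl, hb, hm, hi⟩
    obtain rfl : b = b' := by simpa [e] using hb
    -- The position determines the decomposition of the path, hence the callee and its arguments.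
    obtain ⟨rfl, hp'⟩ := List.append_inj hp hl.symm
    obtain ⟨hc, rfl⟩ := List.cons.inj hp'
    cases hc
    have hallow := over_allows_iff.1 over_allows
    simp only [Blocked, not_forall, not_not] at hallow
    obtain ⟨I, z, hz, hzψ⟩ := hallow
    have hz' := hi I z hzψ
    rcases hm with hm | hm
    · exact models_imp_not_iff.1 (no_overlap ψ' hm) I z (hψ ▸ hzψ) hz'
    · exact hm I z hz hz'
  refine ⟨e, ?_⟩
  exact
    { unreached := hun
      reach_path := H.reach_path
      numReach_eq := fun P b => by
        rw [← H.numReach_eq]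
        simp [numReach, List.countP_append]
      reach_count := H.reach_count
      reach_count_of_no_call := H.reach_count_of_no_call
      fresh_fact := H.fresh_fact
      fresh_reach_count := H.fresh_reach_count
      query_path := fun e' he' => by
        rcases List.mem_cons.1 he' with rfl | he'
        · exact ⟨path, (Atom.call R a, true), by simp [e], trivial⟩
        · exact H.query_path e' he'
      numQuery_eq := fun q' => by
        rw [List.countP_cons, ← H.numQuery_eq]
        simp [numQuery, List.countP_append, List.countP_cons, e]
      query_count := fun e' => by
        have h₀ := H.query_count e'
        rw [List.countP_cons]
        by_cases he : e = e'
        · subst he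
          rw [if_neg hnot] at h₀
          have : e.Exhausted T (Q ∪ {⟨R, ψ, b⟩}) ρ σ :=
            ⟨πu, πv, R, a, b, ψ, path, rfl, rfl, rfl, Or.inl (Or.inr rfl),
              fun I z hz => hψ ▸ hz⟩
          rw [if_pos (by simp), if_pos this]
          omega
        · rw [if_neg (by simpa using he)]
          split_ifs at h₀ with hk
          · have : e'.Exhausted T (Q ∪ {⟨R, ψ, b⟩}) ρ σ :=
              hk.mono subset_rfl (fun _ _ => rfl) fun q' _ hq' => Or.inl (Or.inl hq')
            rw [if_pos this]
            omega
          · omega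
      answer_count := hac
      query_bound := hqb }

theorem Accounting.step (H : Accounting T fresh rs rl ql Q ρ σ)
    (h : Step T φ n (.running Q ρ σ) r (.running Q' ρ' σ')) :
    ∃ rl' ql', Accounting T fresh (rs ++ [r]) rl' ql' Q' ρ' σ' := by
  cases r with
  | sum q => exact ⟨_, _, H.sum_step h⟩
  | reach q => exact ⟨_, _, (H.reach_step h).choose_spec⟩
  | query q q' => exact ⟨_, _, (H.query_step h).choose_spec⟩
  | resUnsafe => cases h
  | resSafe => cases h

end

end Program

end RecMC

/-! ### Counting -/

namespace RecMC

open FirstOrder FirstOrder.Language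

/-- A union bound; the classes `f i` may overlap. -/
theorem countP_le_sum_countP {α ι : Type*} (l : List α) (s : Finset ι) (p : α → Bool)
    (f : ι → α → Bool) (h : ∀ x ∈ l, p x → ∃ i ∈ s, f i x) :
    l.countP p ≤ ∑ i ∈ s, l.countP (f i) := by
  induction l with
  | nil => simp
  | cons x l ih =>
    simp only [List.countP_cons, Finset.sum_add_distrib]
    refine Nat.add_le_add (ih fun y hy => h y (List.mem_cons_of_mem _ hy)) ?_
    split_ifs with hp
    · obtain ⟨i, hi, hf⟩ := h x List.mem_cons_self hp
      refine le_trans ?_ (Finset.single_le_sum (f := fun i => if f i x = true then 1 else 0)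
        (fun _ _ => Nat.zero_le _) hi)
      simp [hf]
    · exact Nat.zero_le _

theorem countP_le_add_countP {α : Type*} (l : List α) (p p₁ p₂ : α → Bool)
    (h : ∀ x ∈ l, p x → p₁ x ∨ p₂ x) : l.countP p ≤ l.countP p₁ + l.countP p₂ := by
  have := countP_le_sum_countP l (Finset.univ : Finset Bool) p (fun i => if i then p₁ else p₂)
    fun x hx hp => by simpa [or_comm] using h x hx hp
  simpa [Fintype.sum_bool] using this

open Classical in
theorem card_filter_getElem? {α : Type*} (p : α → Prop) (l : List α) :
    ((Finset.range l.length).filter fun k => ∃ x, l[k]? = some x ∧ p x).card =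
      l.countP fun x => decide (p x) := by
  induction l with
  | nil => simp
  | cons a l ih =>
    rw [Finset.card_filter] at ih ⊢
    rw [List.length_cons, Finset.sum_range_succ', List.countP_cons, ← ih]
    simp

/-- The closed form that solves the recurrence for `Reach`, with `X` standing for Np. -/
theorem one_add_sum_range_mul_pow (X b : ℕ) :
    1 + ∑ i ∈ Finset.range b, X * (X + 1) ^ i = (X + 1) ^ b := by
  induction b with
  | zero => simp
  | succ b ih => rw [Finset.sum_range_succ, ← add_assoc, ih]; ring

namespace Program

variable {L : FirstOrder.Language.{u, v}} {A : Program L} {T : L.Theory}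
  {φ : L.Formula (A.Formals A.main)} {n : ℕ} {Q : Set A.Triple} {ρ σ : A.AMap}
  {fresh : Prop} {rs : List A.RuleApp} {rl : List A.ReachEvent} {ql : List A.QueryEvent}

theorem card_paths_le (P : A.Proc) : (A.paths P).card ≤ A.maxPaths :=
  Finset.le_sup (f := fun P : A.Proc => (A.paths P).card) (Finset.mem_univ P)

theorem numCalls_le {P : A.Proc} {π : List (Literal L A.toProcSig (A.Vars P))}
    (hπ : π ∈ A.paths P) : numCalls π ≤ A.maxCalls :=
  (Finset.le_sup hπ).trans
    (Finset.le_sup (f := fun P : A.Proc => (A.paths P).sup numCalls) (Finset.mem_univ P))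

theorem one_le_numProcs_mul_maxPaths {P : A.Proc} {π : List (Literal L A.toProcSig (A.Vars P))}
    (hπ : π ∈ A.paths P) : 1 ≤ A.numProcs * A.maxPaths :=
  Nat.mul_pos P.pos ((Finset.card_pos.2 ⟨π, hπ⟩).trans_le (card_paths_le P))

open Classical in
theorem Accounting.numReach_le_sum (H : Accounting T fresh rs rl ql Q ρ σ) (P : A.Proc) (b : ℕ) :
    numReach rs P b ≤ ∑ π ∈ A.paths P, ∑ i ∈ Finset.range (b + 1),
      rl.countP fun e' => decide (e' = ⟨P, π, i⟩) := by
  rw [H.numReach_eq, ← Finset.sum_product']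
  refine countP_le_sum_countP rl _ _
    (fun (j : List (Literal L A.toProcSig (A.Vars P)) × ℕ) e' => decide (e' = ⟨P, j.1, j.2⟩)) ?_
  intro e he hp
  obtain ⟨rfl, hb⟩ := of_decide_eq_true hp
  exact ⟨(e.path, e.bound), Finset.mem_product.2
    ⟨H.reach_path e he, Finset.mem_range.2 (Nat.lt_succ_of_le hb)⟩, by simp⟩

open Classical in
theorem Accounting.reachesBelow_succ_le_sum (H : Accounting T fresh rs rl ql Q ρ σ) (b : ℕ) :
    reachesBelow rl (b + 1) ≤ ∑ P : A.Proc, numReach rs P b := by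
  simp only [H.numReach_eq]
  refine countP_le_sum_countP rl _ _ (fun (P : A.Proc) e => decide (e.proc = P ∧ e.bound ≤ b)) ?_
  intro e he hp
  exact ⟨e.proc, Finset.mem_univ _, by simpa [Nat.lt_succ_iff] using hp⟩

theorem reachesBelow_zero : reachesBelow rl 0 = 0 := by
  simp [reachesBelow]

/-- A bound on the applications of `Reach` to each path bounds all applications of `Reach`. -/
theorem Accounting.reachesBelow_le_of_path (H : Accounting T fresh rs rl ql Q ρ σ) {b d : ℕ}
    (h : ∀ (P : A.Proc), ∀ π ∈ A.paths P, numReach rs P b ≤ (A.paths P).card * d) :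
    reachesBelow rl (b + 1) ≤ A.numProcs * A.maxPaths * d := by
  refine (H.reachesBelow_succ_le_sum b).trans ?_
  have : ∀ P ∈ (Finset.univ : Finset A.Proc), numReach rs P b ≤ A.maxPaths * d := by
    intro P _
    rcases (A.paths P).eq_empty_or_nonempty with h0 | ⟨π, hπ⟩
    · have := H.numReach_le_sum P b
      rw [h0, Finset.sum_empty] at this
      omega
    · exact (h P π hπ).trans (Nat.mul_le_mul_right _ (card_paths_le P))
  refine (Finset.sum_le_card_nsmul _ _ _ this).trans ?_
  simp [mul_assoc]

open Classical in
theorem Accounting.numReach_le_of_path (H : Accounting T fresh rs rl ql Q ρ σ) {P : A.Proc}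
    {b d : ℕ}
    (h : ∀ π ∈ A.paths P, ∑ i ∈ Finset.range (b + 1),
      (rl.countP fun e' => decide (e' = ⟨P, π, i⟩)) ≤ d) :
    numReach rs P b ≤ (A.paths P).card * d := by
  refine (H.numReach_le_sum P b).trans ((Finset.sum_le_card_nsmul _ _ _ h).trans ?_)
  simp

/-- Each of the at most Np paths is reached at bound i at most 1 + `reachesBelow rl i` times; strong
induction and the geometric sum do the rest. No assumption on the initial `ρ` enters, so this also
serves the later calls made by `RecMC`. -/
theorem Accounting.reachesBelow_le (H : Accounting T fresh rs rl ql Q ρ σ) (b : ℕ) :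
    1 + reachesBelow rl b ≤ (A.numProcs * A.maxPaths + 1) ^ b := by
  classical
  induction b using Nat.strong_induction_on with
  | _ b ih =>
  cases b with
  | zero => simp [reachesBelow_zero]
  | succ b =>
    rw [← one_add_sum_range_mul_pow, ← Finset.mul_sum]
    refine Nat.add_le_add_left (H.reachesBelow_le_of_path fun P _ _ =>
      H.numReach_le_of_path fun π hπ => Finset.sum_le_sum fun i hi => ?_) _
    refine (H.reach_count ⟨P, π, i⟩).trans (le_trans ?_ (ih i (Finset.mem_range.1 hi)))
    rw [add_comm]
    refine Nat.add_le_add_right ?_ _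
    split_ifs <;> simp

open Classical in
theorem Accounting.fresh_reach_count_le (H : Accounting T fresh rs rl ql Q ρ σ) (hf : fresh)
    {e : A.ReachEvent} (hc : ∃ l ∈ e.path, l.1.IsCall) :
    (rl.countP fun e' => decide (e' = e)) ≤ reachesBelow rl e.bound := by
  have := H.fresh_reach_count hf e hc
  split_ifs at this <;> omega

/-- The general estimate would give a sum of powers up to exponent b, which is too large. The fresh
start removes the summand 1 for paths with calls, which shifts the sum down by one level; call-free
paths are treated separately. -/
theorem Accounting.numReach_le (H : Accounting T fresh rs rl ql Q ρ σ) (hf : fresh) (b : ℕ) :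
    (∀ P : A.Proc, numReach rs P b ≤ (A.paths P).card * (A.numProcs * A.maxPaths + 1) ^ b) := by
  classical
  induction b using Nat.strong_induction_on with
  | _ b ih =>
  intro P
  refine H.numReach_le_of_path fun π hπ => ?_
  by_cases hc : ∃ l ∈ π, l.1.IsCall
  · rw [Finset.sum_range_succ', ← one_add_sum_range_mul_pow, add_comm]
    refine Nat.add_le_add ?_ (Finset.sum_le_sum fun i hi => ?_)
    · refine (H.fresh_reach_count_le hf (e := ⟨P, π, 0⟩) hc).trans ?_
      simp [reachesBelow_zero]
    · refine (H.fresh_reach_count_le hf (e := ⟨P, π, i + 1⟩) hc).trans ?_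
      exact H.reachesBelow_le_of_path fun P' _ _ => ih i (Finset.mem_range.1 hi) P'
  · push Not at hc
    have h1 : ∀ i ∈ Finset.range (b + 1),
        (rl.countP fun e' => decide (e' = (⟨P, π, i⟩ : A.ReachEvent))) ≤ 1 := fun i _ =>
      (H.reach_count_of_no_call ⟨P, π, i⟩ hc).trans (by split_ifs <;> simp)
    refine (Finset.sum_le_card_nsmul _ _ _ h1).trans ?_
    rw [Finset.card_range, smul_eq_mul, mul_one]
    -- The existence of `π` gives Np ≥ 1, so the base Np + 1 is at least 2.
    calc b + 1 ≤ 2 ^ b := Nat.lt_two_pow_self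
      _ ≤ _ := Nat.pow_le_pow_left (Nat.succ_le_succ (one_le_numProcs_mul_maxPaths hπ)) b

/-- There are at most p paths with at most c call positions each, and each position is used at most
once more than there are `Reach` applications below the bound. -/
theorem Accounting.numQuery_le (H : Accounting T fresh rs rl ql Q ρ σ) (q : A.Triple) :
    numQuery rs q ≤ A.maxCalls * A.maxPaths * (1 + reachesBelow rl q.bound) := by
  classical
  rw [H.numQuery_eq]
  let K : (π : List (Literal L A.toProcSig (A.Vars q.proc))) → Finset ℕ := fun π =>
    (Finset.range π.length).filter fun k => ∃ l, π[k]? = some l ∧ l.1.IsCall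
  have h₁ := countP_le_sum_countP ql ((A.paths q.proc).sigma K)
    (fun e => decide (e.query = q))
    (fun (j : (_ : List (Literal L A.toProcSig (A.Vars q.proc))) × ℕ) e' =>
      decide (e' = ⟨q, j.1, j.2⟩)) (by
    intro e he hp
    obtain rfl := of_decide_eq_true hp
    obtain ⟨hπ, l, hl, hc⟩ := H.query_path e he
    refine ⟨⟨e.path, e.pos⟩, Finset.mem_sigma.2 ⟨hπ, Finset.mem_filter.2 ⟨?_, l, hl, hc⟩⟩, by simp⟩
    exact Finset.mem_range.2 (List.getElem?_eq_some_iff.1 hl).1)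
  refine h₁.trans ?_
  rw [Finset.sum_sigma]
  have h₂ : ∀ π ∈ A.paths q.proc, ∑ k ∈ K π,
      (ql.countP fun e' => decide (e' = (⟨q, π, k⟩ : A.QueryEvent))) ≤
        A.maxCalls * (1 + reachesBelow rl q.bound) := by
    intro π hπ
    have h₃ : ∀ k ∈ K π, (ql.countP fun e' => decide (e' = (⟨q, π, k⟩ : A.QueryEvent))) ≤
        1 + reachesBelow rl q.bound := by
      intro k _
      refine (H.query_count ⟨q, π, k⟩).trans ?_
      rw [add_comm]
      refine Nat.add_le_add_right ?_ _
      split_ifs <;> simp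
    refine (Finset.sum_le_card_nsmul _ _ _ h₃).trans ?_
    rw [smul_eq_mul]
    refine Nat.mul_le_mul_right _ (le_trans (le_of_eq ?_) (numCalls_le hπ))
    unfold numCalls
    convert card_filter_getElem? (fun l : Literal L A.toProcSig (A.Vars q.proc) => l.1.IsCall) π
  refine (Finset.sum_le_card_nsmul _ _ _ h₂).trans ?_
  rw [smul_eq_mul, mul_comm A.maxCalls A.maxPaths, mul_assoc]
  exact Nat.mul_le_mul_right _ (card_paths_le _)

theorem Accounting.numQuery_eq_zero (H : Accounting T fresh rs rl ql Q ρ σ) {q : A.Triple}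
    (hq : q.bound = 0) : numQuery rs q = 0 := by
  classical
  refine List.countP_eq_zero.2 fun r hr h => ?_
  obtain ⟨q', rfl⟩ := of_decide_eq_true h
  have := H.query_bound q q' hr
  omega

/-! ### The work spent on a query -/

/-- A bound on the work spent on a query at bound `b`, when `Query` is applied at most `f b` times
to each such query. -/
def workBound (f : ℕ → ℕ) : ℕ → ℕ
  | 0 => 1
  | b + 1 => 1 + f (b + 1) * (1 + workBound f b)

/-- A descendant of `q` is `q` itself or descends from a child. On `q` itself there is at most one
answer besides the `Query` applications, which also bound the number of children. Children have
bounds smaller by one, so induction on the bound applies. -/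
theorem Accounting.work_le (H : Accounting T fresh rs rl ql Q ρ σ) {f : ℕ → ℕ}
    (hf : ∀ q, numQuery rs q ≤ f q.bound) (q : A.Triple) : work rs q ≤ workBound f q.bound := by
  classical
  have key : ∀ q : A.Triple, ∃ s : Finset A.Triple, s.card ≤ numQuery rs q ∧
      (∀ q' ∈ s, RuleApp.query q q' ∈ rs) ∧
      work rs q ≤ 1 + numQuery rs q + ∑ q' ∈ s, work rs q' := by
    intro q
    -- The default `q` is never used: only applications of `Query` pass the filter below.
    let child : A.RuleApp → A.Triple := fun r => match r with
      | .query _ q' => q'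
      | _ => q
    let s : Finset A.Triple :=
      ((rs.filter fun r => decide (∃ q', r = .query q q')).map child).toFinset
    have hs : ∀ q', q' ∈ s ↔ RuleApp.query q q' ∈ rs := by
      intro q'
      simp only [s, List.mem_toFinset, List.mem_map, List.mem_filter, decide_eq_true_eq]
      constructor
      · rintro ⟨r, ⟨hr, q'', rfl⟩, rfl⟩
        exact hr
      · exact fun h => ⟨_, ⟨h, q', rfl⟩, rfl⟩
    refine ⟨s, ?_, fun q' => (hs q').1, ?_⟩
    · refine (List.toFinset_card_le _).trans ?_
      rw [List.length_map, ← List.countP_eq_length_filter]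
      rfl
    · refine (countP_le_add_countP rs _ (fun r => decide (r.On q))
        (fun r => decide (∃ q₁ ∈ s, ∃ q', Descends rs q₁ q' ∧ r.On q')) ?_).trans
        (Nat.add_le_add ?_ ?_)
      · intro r _ hr
        obtain ⟨q', hd, hon⟩ := of_decide_eq_true hr
        rcases Relation.ReflTransGen.cases_head hd with rfl | ⟨q₁, hq₁, hd⟩
        · exact Or.inl (decide_eq_true hon)
        · exact Or.inr (decide_eq_true ⟨q₁, (hs q₁).2 hq₁, q', hd, hon⟩)
      · refine (countP_le_add_countP rs _ (fun r => decide (r = .sum q ∨ r = .reach q))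
          (fun r => decide (∃ q', r = .query q q')) ?_).trans (Nat.add_le_add_right ?_ _)
        · intro r _ hr
          have hr := of_decide_eq_true hr
          cases r <;> simp_all [RuleApp.On]
        · exact (H.answer_count q).trans (by split_ifs <;> simp)
      · refine countP_le_sum_countP rs s _
          (fun q₁ r => decide (∃ q', Descends rs q₁ q' ∧ r.On q')) fun r _ hr => ?_
        obtain ⟨q₁, hq₁, h⟩ := of_decide_eq_true hr
        exact ⟨q₁, hq₁, decide_eq_true h⟩
  obtain ⟨P, χ, b⟩ := q
  induction b generalizing P with
  | zero =>
    obtain ⟨s, hs, -, hw⟩ := key ⟨P, χ, 0⟩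
    have h0 := H.numQuery_eq_zero (q := ⟨P, χ, 0⟩) rfl
    obtain rfl : s = ∅ := Finset.card_eq_zero.1 (by omega)
    simpa [h0, workBound] using hw
  | succ b ih =>
    obtain ⟨s, hs, hm, hw⟩ := key ⟨P, χ, b + 1⟩
    have h₁ : ∀ q' ∈ s, work rs q' ≤ workBound f b := by
      rintro ⟨R, ψ, c⟩ hq'
      have hb := H.query_bound _ _ (hm _ hq')
      obtain rfl : b = c := by simpa using hb
      exact ih R ψ
    have h₂ : ∑ q' ∈ s, work rs q' ≤ _ := Finset.sum_le_card_nsmul _ _ _ h₁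
    have h₃ := hf ⟨P, χ, b + 1⟩
    rw [smul_eq_mul] at h₂
    have h₄ : s.card * workBound f b ≤ f (b + 1) * workBound f b :=
      Nat.mul_le_mul_right _ (hs.trans h₃)
    simp only [workBound, mul_add, mul_one] at h₃ ⊢
    omega

/-! ### Runs -/

theorem Accounting.result_step (H : Accounting T fresh rs rl ql Q ρ σ) {r : A.RuleApp}
    (hr : r = .resUnsafe ∨ r = .resSafe) : Accounting T fresh (rs ++ [r]) rl ql Q ρ σ :=
  { H with
    numReach_eq := fun P b => by
      rw [← H.numReach_eq]
      rcases hr with rfl | rfl <;> simp [numReach, List.countP_append]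
    numQuery_eq := fun q => by
      rw [← H.numQuery_eq]
      rcases hr with rfl | rfl <;> simp [numQuery, List.countP_append]
    answer_count := fun q => by
      refine le_trans (le_of_eq ?_) (H.answer_count q)
      rcases hr with rfl | rfl <;> simp [List.countP_append]
    query_bound := fun q q' h => by
      refine H.query_bound q q' ?_
      rcases hr with rfl | rfl <;> simpa using h }

theorem Step.result_or_running {s s' : A.State} {r : A.RuleApp} (h : Step T φ n s r s') :
    ∃ Q ρ σ, s = .running Q ρ σ ∧
      ((∃ Q' ρ' σ', s' = .running Q' ρ' σ') ∨ s'.IsFinal ∧ (r = .resUnsafe ∨ r = .resSafe)) := by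
  cases h with
  | sum => exact ⟨_, _, _, rfl, Or.inl ⟨_, _, _, rfl⟩⟩
  | reach => exact ⟨_, _, _, rfl, Or.inl ⟨_, _, _, rfl⟩⟩
  | query => exact ⟨_, _, _, rfl, Or.inl ⟨_, _, _, rfl⟩⟩
  | resUnsafe => exact ⟨_, _, _, rfl, Or.inr ⟨trivial, Or.inl rfl⟩⟩
  | resSafe => exact ⟨_, _, _, rfl, Or.inr ⟨trivial, Or.inr rfl⟩⟩

/-- After a result has been returned, the accounting refers to the last running state; no rule can
follow. -/
theorem Run.accounting {Q₀ : Set A.Triple} {ρ₀ σ₀ : A.AMap} {s : A.State}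
    (h : Run T φ n (.running Q₀ ρ₀ σ₀) rs s) (hfresh : fresh → ρ₀ = ∅)
    (hQ : ∀ q ∈ Q₀, Unreached T ρ₀ q) :
    ∃ rl ql Q ρ σ, Accounting T fresh rs rl ql Q ρ σ ∧ (s = .running Q ρ σ ∨ s.IsFinal) := by
  induction h with
  | nil => exact ⟨[], [], Q₀, ρ₀, σ₀, Accounting.initial hfresh hQ, Or.inl rfl⟩
  | snoc _ hstep ih =>
    obtain ⟨rl, ql, Q, ρ, σ, H, hs⟩ := ih
    obtain ⟨Q₁, ρ₁, σ₁, rfl, hcase⟩ := hstep.result_or_running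
    obtain ⟨rfl, rfl, rfl⟩ : Q₁ = Q ∧ ρ₁ = ρ ∧ σ₁ = σ := by simpa [State.IsFinal] using hs
    rcases hcase with ⟨Q', ρ', σ', rfl⟩ | ⟨hfin, hr⟩
    · obtain ⟨rl', ql', H'⟩ := H.step hstep
      exact ⟨rl', ql', Q', ρ', σ', H', Or.inl rfl⟩
    · exact ⟨rl, ql, Q₁, ρ₁, σ₁, H.result_step hr, Or.inr hfin⟩

theorem Descends.append {q q' : A.Triple} (h : Descends rs q q') (rs' : List A.RuleApp) :
    Descends (rs ++ rs') q q' :=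
  Relation.ReflTransGen.mono (fun _ _ hm => List.mem_append_left _ hm) _ _ h

/-- All rules of a run are applied to descendants of the initial query, except for the one that
returns the result. -/
theorem Run.length_le {q₀ : A.Triple} {ρ₀ σ₀ : A.AMap} {s : A.State}
    (h : Run T φ n (.running {q₀} ρ₀ σ₀) rs s) : rs.length ≤ work rs q₀ + 1 := by
  classical
  have key : (∀ Q ρ σ, s = .running Q ρ σ → (∀ q ∈ Q, Descends rs q₀ q) ∧
      ∀ r ∈ rs, ∃ q, Descends rs q₀ q ∧ r.On q) ∧ rs.length ≤ work rs q₀ + 1 := by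
    induction h with
    | nil =>
      refine ⟨?_, by simp⟩
      rintro Q ρ σ h
      cases h
      exact ⟨fun q hq => hq ▸ Relation.ReflTransGen.refl, by simp⟩
    | @snoc rs s' s'' r _ hstep ih =>
      obtain ⟨Q₁, ρ₁, σ₁, rfl, hcase⟩ := hstep.result_or_running
      obtain ⟨hQ, hrs⟩ := ih.1 _ _ _ rfl
      have hrs' : ∀ r' ∈ rs, ∃ q, Descends (rs ++ [r]) q₀ q ∧ r'.On q := fun r' hr' =>
        let ⟨q, hd, hon⟩ := hrs r' hr'
        ⟨q, hd.append _, hon⟩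
      have hlen : rs.length ≤ rs.countP fun r' =>
          decide (∃ q, Descends (rs ++ [r]) q₀ q ∧ r'.On q) := by
        rw [List.countP_eq_length.2 fun r' hr' => decide_eq_true (hrs' r' hr')]
      constructor
      · rintro Q ρ σ rfl
        have hall : ∀ q ∈ Q₁, Descends (rs ++ [r]) q₀ q := fun q hq => (hQ q hq).append _
        constructor
        · intro q hq
          rcases hstep.mem_or_created hq with hq | ⟨q₁, rfl⟩
          · exact hall q hq
          · exact (hall q₁ (hstep.mem_of_on rfl)).tail (by simp)
        · intro r' hr'
          rcases List.mem_append.1 hr' with hr' | hr'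
          · exact hrs' r' hr'
          · rw [List.mem_singleton] at hr'
            subst hr'
            obtain ⟨q, hq, hon⟩ := hstep.exists_on
            exact ⟨q, hall q hq, hon⟩
      · unfold work
        rw [List.length_append, List.countP_append, List.length_singleton]
        omega
  exact key.2

end Program

end RecMC

/-! ### Bounds for runs that start without reachability facts -/

namespace RecMC

open FirstOrder FirstOrder.Language

namespace Program

variable {L : FirstOrder.Language.{u, v}} {A : Program L} {T : L.Theory}
  {φ : L.Formula (A.Formals A.main)} {n : ℕ}

section Bounds

variable {Q : Set A.Triple} {ρ σ : A.AMap} {fresh : Prop} {rs : List A.RuleApp}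
  {rl : List A.ReachEvent} {ql : List A.QueryEvent}

theorem exists_call_of_maxCalls_ne_zero (h : A.maxCalls ≠ 0) :
    ∃ (P : A.Proc), ∃ π ∈ A.paths P, ∃ l ∈ π, l.1.IsCall := by
  classical
  by_contra hcon
  push Not at hcon
  refine h ((Finset.sup_eq_bot_iff _ _).2 fun P _ => (Finset.sup_eq_bot_iff _ _).2 fun π hπ => ?_)
  exact List.countP_eq_zero.2 fun l hl hc => hcon P π hπ l hl (of_decide_eq_true hc)

/-- If the only path of the program contains a call, then nothing is reachable. -/
theorem Accounting.reachesBelow_eq_zero (H : Accounting T fresh rs rl ql Q ρ σ) (hf : fresh)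
    (h1 : A.numProcs * A.maxPaths = 1) (hc : A.maxCalls ≠ 0) (b : ℕ) : reachesBelow rl b = 0 := by
  have hcall : ∀ (P : A.Proc), ∀ π ∈ A.paths P, ∃ l ∈ π, l.1.IsCall := by
    obtain ⟨P₀, π₀, hπ₀, hl⟩ := exists_call_of_maxCalls_ne_zero hc
    intro P π hπ
    have hN := Nat.eq_one_of_mul_eq_one_right h1
    have hp := Nat.eq_one_of_mul_eq_one_left h1
    obtain rfl : P = P₀ := Fin.ext (by omega)
    rwa [Finset.card_le_one.1 ((card_paths_le P).trans hp.le) π hπ π₀ hπ₀]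
  induction b using Nat.strong_induction_on with
  | _ b ih =>
  cases b with
  | zero => exact reachesBelow_zero
  | succ b =>
    refine Nat.le_zero.1 (H.reachesBelow_le_of_path (d := 0) fun P _ _ =>
      H.numReach_le_of_path fun π hπ => le_of_eq (Finset.sum_eq_zero fun i hi => ?_))
    have := H.fresh_reach_count_le hf (e := ⟨P, π, i⟩) (hcall P π hπ)
    rwa [ih i (Finset.mem_range.1 hi), Nat.le_zero] at this

/-- Powers of Np + 1 are absorbed into powers of Np via X + 1 ≤ X² when X = Np ≥ 2. For X = 0 there
are no paths. For X = 1 this fails, but then either there are no calls at all or the only path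
contains one, and nothing is ever reached. -/
theorem Accounting.fresh_numQuery_le (H : Accounting T fresh rs rl ql Q ρ σ) (hf : fresh)
    (q : A.Triple) : numQuery rs q ≤
      max A.maxCalls 1 * max (A.numProcs * A.maxPaths) 1 ^ (2 * q.bound + 1) := by
  have h := H.numQuery_le q
  have hN : 1 ≤ A.numProcs := A.main.pos
  have hpX : A.maxPaths ≤ A.numProcs * A.maxPaths := Nat.le_mul_of_pos_left _ hN
  refine h.trans ?_
  by_cases h0 : A.maxCalls = 0
  · simp [h0]
  rw [mul_assoc]
  refine Nat.mul_le_mul (le_max_left _ _) ?_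
  rcases Nat.lt_trichotomy (A.numProcs * A.maxPaths) 1 with hX | hX | hX
  · have : A.maxPaths = 0 := by omega
    simp [this]
  · rw [H.reachesBelow_eq_zero hf hX h0, hX]
    simp only [max_self, one_pow]
    omega
  · rw [max_eq_left hX.le]
    have hsq : A.numProcs * A.maxPaths + 1 ≤ (A.numProcs * A.maxPaths) ^ 2 := by nlinarith
    have h1 := (H.reachesBelow_le q.bound).trans (Nat.pow_le_pow_left hsq q.bound)
    rw [← pow_mul] at h1
    rw [pow_succ, mul_comm (_ ^ _)]
    exact Nat.mul_le_mul hpX h1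

/-- Each level multiplies by c · X^(2b+1), and the sum of 2i + 1 over i = 1, …, b is b² + 2b. The
additive terms are absorbed by the factor 2b + 1, which grows by two per level. -/
theorem workBound_le {c X : ℕ} (hc : 1 ≤ c) (hX : 1 ≤ X) (b : ℕ) :
    workBound (fun b => c * X ^ (2 * b + 1)) b ≤ (2 * b + 1) * (c ^ b * X ^ (b ^ 2 + 2 * b)) := by
  induction b with
  | zero => simp [workBound]
  | succ b ih =>
    have hZ : 1 ≤ c ^ b * X ^ (b ^ 2 + 2 * b) := Nat.mul_pos (pow_pos hc _) (pow_pos hX _)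
    have hY : 1 ≤ c * X ^ (2 * (b + 1) + 1) := Nat.mul_pos hc (pow_pos hX _)
    have hYZ : c ^ (b + 1) * X ^ ((b + 1) ^ 2 + 2 * (b + 1)) =
        (c * X ^ (2 * (b + 1) + 1)) * (c ^ b * X ^ (b ^ 2 + 2 * b)) := by ring
    rw [workBound, hYZ]
    generalize c ^ b * X ^ (b ^ 2 + 2 * b) = Z at *
    generalize c * X ^ (2 * (b + 1) + 1) = Y at *
    have h₁ := Nat.mul_le_mul_left Y ih
    have h₂ : Y ≤ Y * Z := Nat.le_mul_of_pos_right _ hZ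
    nlinarith

theorem Accounting.fresh_work_le (H : Accounting T fresh rs rl ql Q ρ σ) (hf : fresh)
    (q : A.Triple) : work rs q ≤ 3 * max q.bound 1 * max A.maxCalls 1 ^ q.bound *
      max (A.numProcs * A.maxPaths) 1 ^ (4 * q.bound ^ 2) := by
  have hX : 1 ≤ max (A.numProcs * A.maxPaths) 1 := le_max_right _ _
  refine (H.work_le (H.fresh_numQuery_le hf) q).trans
    ((workBound_le (le_max_right _ _) hX _).trans ?_)
  rw [mul_assoc (3 * _)]
  refine Nat.mul_le_mul (by omega) (Nat.mul_le_mul_left _ (Nat.pow_le_pow_right hX ?_))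
  nlinarith [Nat.le_self_pow (two_ne_zero) q.bound]

end Bounds

/-! ### Termination of `BndSafety` -/

/-- A cruder bound that allows a nonempty initial `ρ`, as needed when `RecMC` reuses its maps; hence
`fresh` is `False`. -/
theorem Run.length_le_workBound {q₀ : A.Triple} {ρ₀ σ₀ : A.AMap} {s : A.State}
    {rs : List A.RuleApp} (h : Run T φ n (.running {q₀} ρ₀ σ₀) rs s)
    (hq₀ : Unreached T ρ₀ q₀) :
    rs.length ≤ workBound (fun b => A.maxCalls * A.maxPaths *
      (A.numProcs * A.maxPaths + 1) ^ b) q₀.bound + 1 := by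
  obtain ⟨rl, ql, Q, ρ, σ, H, -⟩ := h.accounting (fresh := False) False.elim
    (by rintro q rfl; exact hq₀)
  refine h.length_le.trans (Nat.add_le_add_right (H.work_le (fun q => ?_) q₀) 1)
  exact (H.numQuery_le q).trans (Nat.mul_le_mul_left _ (H.reachesBelow_le q.bound))

theorem acc_bndStep {q₀ : A.Triple} {ρ₀ σ₀ : A.AMap} (hq₀ : Unreached T ρ₀ q₀) :
    Acc (fun s' s => BndStep T φ n s s') (.running {q₀} ρ₀ σ₀) := by
  by_contra hacc
  obtain ⟨f, hf₀, hf⟩ := not_acc_iff_exists_descending_chain.1 hacc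
  have hrun : ∀ k, ∃ rs, Run T φ n (.running {q₀} ρ₀ σ₀) rs (f k) ∧ rs.length = k := by
    intro k
    induction k with
    | zero => exact ⟨[], hf₀ ▸ Run.nil, rfl⟩
    | succ k ih =>
      obtain ⟨rs, hr, hl⟩ := ih
      obtain ⟨r, hstep⟩ := hf k
      exact ⟨rs ++ [r], hr.snoc hstep, by simp [hl]⟩
  obtain ⟨rs, hr, hl⟩ := hrun (workBound (fun b => A.maxCalls * A.maxPaths *
      (A.numProcs * A.maxPaths + 1) ^ b) q₀.bound + 2)
  have := hr.length_le_workBound hq₀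
  omega

theorem not_exists_chain_of_acc {α : Type*} {step : α → α → Prop} {s₀ : α}
    (h : Acc (fun s' s => step s s') s₀) :
    ¬ ∃ s : ℕ → α, s 0 = s₀ ∧ ∀ i, step (s i) (s (i + 1)) :=
  fun hc => not_acc_iff_exists_descending_chain.2 hc h

/-! ### Soundness of the assertion maps -/

section Semantics

variable (M : Type*) [L.Structure M]

theorem bodySet_mono {X Y : Interp A.toProcSig M} (h : ∀ P, X P ⊆ Y P) (P : A.Proc) :
    A.bodySet M X P ⊆ A.bodySet M Y P :=
  fun _ ⟨y, hy⟩ => ⟨y, QF.realize_mono h (A.body_positive P) hy⟩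

variable (A) in
/-- The interpretation of the calls in the bounded semantics. -/
def predSem : ℕ → Interp A.toProcSig M
  | 0 => fun _ => ∅
  | b + 1 => A.boundedSem M b

theorem boundedSem_eq (b : ℕ) : A.boundedSem M b = A.bodySet M (A.predSem M b) := by
  cases b <;> rfl

theorem boundedSem_subset_succ (b : ℕ) (P : A.Proc) :
    A.boundedSem M b P ⊆ A.boundedSem M (b + 1) P := by
  induction b generalizing P with
  | zero => exact bodySet_mono M (fun _ => Set.empty_subset _) P
  | succ b ih => exact bodySet_mono M ih P

theorem boundedSem_mono {b c : ℕ} (h : b ≤ c) (P : A.Proc) :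
    A.boundedSem M b P ⊆ A.boundedSem M c P := by
  induction h with
  | refl => exact subset_rfl
  | step _ ih => exact ih.trans (boundedSem_subset_succ M _ P)

theorem sem_subset {X : Interp A.toProcSig M} (h : ∀ P, A.bodySet M X P ⊆ X P) (P : A.Proc) :
    A.sem M P ⊆ X P := by
  have : A.sem M ≤ X := sInf_le fun Q x y hx => h Q ⟨y, hx⟩
  exact this P

theorem boundedSem_subset_sem (b : ℕ) (P : A.Proc) : A.boundedSem M b P ⊆ A.sem M P := by
  have : A.boundedSem M b ≤ A.sem M := by
    refine le_sInf fun X hX => ?_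
    have hX' : ∀ Y : Interp A.toProcSig M, (∀ P, Y P ⊆ X P) → A.bodySet M Y ≤ X :=
      fun Y hY P x ⟨y, hy⟩ => hX P x y (QF.realize_mono hY (A.body_positive P) hy)
    induction b with
    | zero => exact hX' _ fun _ => Set.empty_subset _
    | succ b ih => exact hX' _ ih
  exact this P

/-- The union of the bounded semantics is closed under the bodies, since a body true in the union is
true at a finite stage. -/
theorem sem_subset_iUnion (P : A.Proc) : A.sem M P ⊆ ⋃ b, A.boundedSem M b P := by
  refine sem_subset M (X := fun P => ⋃ b, A.boundedSem M b P) ?_ P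
  rintro Q x ⟨y, hy⟩
  obtain ⟨b, hb⟩ := QF.realize_iUnion (fun b c h P => boundedSem_mono M h P)
    (A.body_positive Q) hy
  exact Set.mem_iUnion.2 ⟨b + 1, y, hb⟩

end Semantics

theorem realize_of_body_models (I : Theory.ModelType.{u, v, max u v} T) {P : A.Proc}
    {E : Env L A.toProcSig} {δ : L.Formula (A.Formals P)}
    (h : T ⊨ᵇ ((A.body P).inst E).imp (δ.relabel Sum.inl)) {X : Interp A.toProcSig I}
    (hX : ∀ P, X P ⊆ E.interp I P) {x : A.Formals P → I} (hx : x ∈ A.bodySet I X P) :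
    δ.Realize x := by
  obtain ⟨y, hy⟩ := hx
  have := models_imp_iff.1 h I (Sum.elim x y)
    ((QF.realize_inst _ _ _).2 (QF.realize_mono hX (A.body_positive P) hy))
  simpa using realize_relabel_inl.1 this

/-- The facts in `ρ` are reachable, the facts in `σ` are summaries, and all of them have bounds at
most `n`. -/
structure SoundMaps (T : L.Theory) (n : ℕ) (ρ σ : A.AMap) : Prop where
  reachable : ∀ t ∈ ρ, ∀ (I : Theory.ModelType.{u, v, max u v} T) (x : A.Formals t.proc → I),
    t.fml.Realize x → x ∈ A.boundedSem I t.bound t.proc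
  summary : ∀ t ∈ σ, ∀ (I : Theory.ModelType.{u, v, max u v} T) (x : A.Formals t.proc → I),
    x ∈ A.boundedSem I t.bound t.proc → t.fml.Realize x
  bound_reachable : ∀ t ∈ ρ, t.bound ≤ n
  bound_summary : ∀ t ∈ σ, t.bound ≤ n

namespace SoundMaps

variable {ρ σ : A.AMap}

theorem underEnv_subset (H : SoundMaps T n ρ σ)
    (I : Theory.ModelType.{u, v, max u v} T) (b : ℕ) (P : A.Proc) :
    (underEnv ρ b).interp I P ⊆ A.boundedSem I b P := by
  intro x hx
  obtain ⟨δ, b', hb', hδ, hr⟩ := mem_underEnv.1 hx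
  exact boundedSem_mono I hb' P (H.reachable _ hδ I x hr)

theorem subset_overEnv (H : SoundMaps T n ρ σ)
    (I : Theory.ModelType.{u, v, max u v} T) (b : ℕ) (P : A.Proc) :
    A.boundedSem I b P ⊆ (overEnv σ b).interp I P :=
  fun x hx => mem_overEnv.2 fun _ _ hb' hδ => H.summary _ hδ I x (boundedSem_mono I hb' P hx)

theorem underEnvPred_subset (H : SoundMaps T n ρ σ)
    (I : Theory.ModelType.{u, v, max u v} T) (b : ℕ) (P : A.Proc) :
    (underEnvPred ρ b).interp I P ⊆ A.predSem I b P := by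
  cases b with
  | zero => exact fun _ hx => absurd hx id
  | succ b => exact H.underEnv_subset I b P

theorem subset_overEnvPred (H : SoundMaps T n ρ σ)
    (I : Theory.ModelType.{u, v, max u v} T) (b : ℕ) (P : A.Proc) :
    A.predSem I b P ⊆ (overEnvPred σ b).interp I P := by
  cases b with
  | zero => exact Set.empty_subset _
  | succ b => exact H.subset_overEnv I b P

end SoundMaps

theorem SoundMaps.push {ρ σ : A.AMap} (H : SoundMaps T n ρ σ) :
    SoundMaps T (n + 1) ρ (push T σ n) := by
  classical
  have hmem : ∀ t ∈ Program.push T σ n, t ∈ σ ∨ t.bound = n + 1 ∧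
      T ⊨ᵇ ((A.body t.proc).inst (overEnv σ n)).imp (t.fml.relabel Sum.inl) := by
    intro t ht
    rcases Finset.mem_union.1 ht with ht | ht
    · exact Or.inl ht
    · obtain ⟨t', ht', rfl⟩ := Finset.mem_image.1 ht
      -- A pushed fact has passed the test against `O_σ^n`, which contains the bounded semantics at
      -- `n`; hence it is a summary at `n + 1`.
      exact Or.inr ⟨rfl, (Finset.mem_filter.1 ht').2.2⟩
  refine ⟨H.reachable, ?_, fun t ht => (H.bound_reachable t ht).trans n.le_succ, ?_⟩
  · intro t ht I x hx
    rcases hmem t ht with ht | ⟨hb, hm⟩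
    · exact H.summary t ht I x hx
    · rw [hb] at hx
      exact realize_of_body_models I hm (H.subset_overEnv I n) hx
  · intro t ht
    rcases hmem t ht with ht | ⟨hb, -⟩
    · exact (H.bound_summary t ht).trans n.le_succ
    · exact hb.le

/-! ### Invariants of `BndSafety` and `RecMC` -/

/-- The invariant of the states of `BndSafety`. -/
def State.Inv (T : L.Theory) (φ : L.Formula (A.Formals A.main)) (n : ℕ) : A.State → Prop
  | .running Q ρ σ => SoundMaps T n ρ σ ∧ (∀ q ∈ Q, q.bound ≤ n) ∧
      ((⟨A.main, ∼φ, n⟩ : A.Triple) ∈ Q ∨ Answered T ρ σ ⟨A.main, ∼φ, n⟩)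
  | .resUnsafe ρ σ => SoundMaps T n ρ σ ∧ ¬ T ⊨ᵇ (underEnv ρ n A.main).imp φ
  | .resSafe ρ σ => SoundMaps T n ρ σ ∧ T ⊨ᵇ (overEnv σ n A.main).imp φ

theorem SoundMaps.empty : SoundMaps T n (∅ : A.AMap) ∅ := by
  constructor <;> simp

theorem inv_init {ρ σ : A.AMap} (h : SoundMaps T n ρ σ) : (init φ n ρ σ).Inv T φ n :=
  ⟨h, by rintro q rfl; exact le_rfl, Or.inl rfl⟩

theorem Step.soundMaps {Q Q' : Set A.Triple} {ρ ρ' σ σ' : A.AMap} {r : A.RuleApp}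
    (h : Step T φ n (.running Q ρ σ) r (.running Q' ρ' σ')) (H : SoundMaps T n ρ σ)
    (hQ : ∀ q ∈ Q, q.bound ≤ n) : SoundMaps T n ρ' σ' := by
  classical
  cases h with
  | sum _ _ _ P χ b ψ mem blocked itp_left itp_right =>
    refine ⟨H.reachable, fun t ht I x hx => ?_, H.bound_reachable, fun t ht => ?_⟩
    · rcases Finset.mem_insert.1 ht with rfl | ht
      · rw [boundedSem_eq] at hx
        exact realize_of_body_models I itp_left (H.subset_overEnvPred I b) hx
      · exact H.summary t ht I x hx
    · rcases Finset.mem_insert.1 ht with rfl | ht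
      · exact hQ ⟨P, χ, b⟩ mem
      · exact H.bound_summary t ht
  | reach _ _ _ P χ b π mem path feasible =>
    refine ⟨fun t ht I x hx => ?_, H.summary, fun t ht => ?_, H.bound_summary⟩
    · rcases Finset.mem_insert.1 ht with rfl | ht
      · obtain ⟨y, hy⟩ := realize_reachFact.1 hx
        rw [boundedSem_eq]
        exact ⟨y, QF.realize_mono (H.underEnvPred_subset I b) (A.body_positive P)
          (body_realize_of_path path hy)⟩
      · exact H.reachable t ht I x hx
    · rcases Finset.mem_insert.1 ht with rfl | ht
      · exact hQ ⟨P, χ, b⟩ mem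
      · exact H.bound_reachable t ht
  | query => exact H

theorem BndStep.inv {s s' : A.State} (h : BndStep T φ n s s') (H : s.Inv T φ n) :
    s'.Inv T φ n := by
  obtain ⟨r, h⟩ := h
  obtain ⟨Q, ρ, σ, rfl, ⟨Q', ρ', σ', rfl⟩ | ⟨hfin, -⟩⟩ := h.result_or_running
  · refine ⟨h.soundMaps H.1 H.2.1, fun q hq => ?_, ?_⟩
    · rcases h.mem_or_created hq with hq | ⟨q₀, rfl⟩
      · exact H.2.1 q hq
      · have h₁ := h.bound_of_query
        have h₂ := H.2.1 q₀ (h.mem_of_on rfl)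
        omega
    · rcases H.2.2 with hq | hq
      · exact or_iff_not_imp_left.2 (h.answered hq)
      · exact Or.inr (hq.mono h.under_subset h.over_subset)
  · cases h with
    | resUnsafe _ _ reached => exact ⟨H.1, reached⟩
    | resSafe _ _ blocked => exact ⟨H.1, blocked⟩
    | _ => exact absurd hfin id

/-- With no open query left, the initial query has been answered: a negative answer enables SAFE, a
positive one UNSAFE. -/
theorem isFinal_of_stuck {s : A.State} (H : s.Inv T φ n)
    (hs : ¬ ∃ s', BndStep T φ n s s') : s.IsFinal := by
  cases s with
  | resUnsafe => trivial
  | resSafe => trivial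
  | running Q ρ σ =>
    refine absurd ?_ hs
    rcases Q.eq_empty_or_nonempty with rfl | ⟨q, hq⟩
    · rcases H.2.2.resolve_left id with hb | hr
      · refine ⟨_, _, Step.resSafe ρ σ (models_imp_iff.2 fun I x hx => ?_)⟩
        exact not_not.1 (hb I x hx)
      · refine ⟨_, _, Step.resUnsafe ρ σ fun hm => hr fun I x hx hφ => ?_⟩
        exact hφ (models_imp_iff.1 hm I x hx)
    · exact exists_step_of_mem ρ σ hq

theorem inv_of_reachable {s₀ s : A.State} (h : Relation.ReflTransGen (BndStep T φ n) s₀ s)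
    (H : s₀.Inv T φ n) : s.Inv T φ n := by
  induction h with
  | refl => exact H
  | tail _ hstep ih => exact hstep.inv ih

theorem terminates_bndSafety (n : ℕ) :
    Terminates (BndStep T φ n) (init φ n ∅ ∅) State.IsFinal := by
  refine ⟨not_exists_chain_of_acc (acc_bndStep fun I x hx => ?_), fun s hs =>
    isFinal_of_stuck (inv_of_reachable hs (inv_init SoundMaps.empty))⟩
  obtain ⟨_, _, -, h, -⟩ := mem_underEnv.1 hx
  simp at h

/-! ### The main loop -/

/-- The invariant of the states of `RecMC`. -/
def RecState.Inv (T : L.Theory) (φ : L.Formula (A.Formals A.main)) : A.RecState → Prop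
  | .bnd n s => s.Inv T φ n
  | .retUnsafe ρ => ∃ n σ, SoundMaps T n ρ σ ∧ ¬ T ⊨ᵇ (underEnv ρ n A.main).imp φ
  | .retSafe _ => A.Satisfies T φ

/-- If every fact passes the test, `O_σ^n` is closed under the bodies and thus contains the least
interpretation. -/
theorem satisfies_of_isInductive {ρ σ : A.AMap} (H : SoundMaps T n ρ σ)
    (hsafe : T ⊨ᵇ (overEnv σ n A.main).imp φ) (hind : IsInductive T σ n) : A.Satisfies T φ := by
  intro I x hx
  refine models_imp_iff.1 hsafe I x
    (sem_subset I (X := (overEnv σ n).interp I) (fun P y hy => mem_overEnv.2 ?_) A.main hx)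
  intro δ b hb hδ
  -- No fact of `σ` lies above `n`, so testing those at `n` suffices.
  obtain rfl : b = n := le_antisymm (H.bound_summary _ hδ) hb
  exact realize_of_body_models I (hind P δ hδ) (fun _ => subset_rfl) hy

theorem RecStep.inv {s s' : A.RecState} (h : RecStep T φ s s') (H : s.Inv T φ) :
    s'.Inv T φ := by
  cases h with
  | inner n s s' h => exact h.inv H
  | retUnsafe n ρ σ => exact ⟨n, σ, H⟩
  | retSafe n ρ σ h => exact satisfies_of_isInductive H.1 H.2 h
  | next n ρ σ h => exact inv_init H.1.push

theorem recInv_of_reachable {s : A.RecState}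
    (h : Relation.ReflTransGen (RecStep T φ) (recInit φ) s) : s.Inv T φ := by
  induction h with
  | refl => exact inv_init SoundMaps.empty
  | tail _ hstep ih => exact hstep.inv ih

/-- The initial query of the next call must be unreached for the accounting to start. All facts of
`ρ` have bounds at most `n`, hence lie in `O_σ^n` and satisfy `φ`. -/
theorem SoundMaps.unreached_succ {ρ σ : A.AMap} (H : SoundMaps T n ρ σ)
    (hsafe : T ⊨ᵇ (overEnv σ n A.main).imp φ) :
    Unreached T ρ ⟨A.main, ∼φ, n + 1⟩ := by
  intro I x hx
  obtain ⟨δ, b, -, hδ, hr⟩ := mem_underEnv.1 hx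
  refine not_not.2 (models_imp_iff.1 hsafe I x (H.subset_overEnv I n _ ?_))
  exact H.underEnv_subset I n _ (mem_underEnv.2 ⟨δ, b, H.bound_reachable _ hδ, hδ, hr⟩)

/-- Well-founded induction inside one call of `BndSafety`; the only way into another call is a SAFE
result, which `hnext` handles. -/
theorem acc_recStep_bnd {s : A.State} (hs : Acc (fun s' s => BndStep T φ n s s') s)
    (H : s.Inv T φ n)
    (hnext : ∀ ρ σ : A.AMap, (State.resSafe ρ σ).Inv T φ n →
      Acc (fun s' s => RecStep T φ s s') (.bnd (n + 1) (init φ (n + 1) ρ (push T σ n)))) :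
    Acc (fun s' s => RecStep T φ s s') (.bnd n s) := by
  induction hs with
  | intro s _ ih =>
    refine Acc.intro _ fun s' h => ?_
    cases h with
    | inner _ _ s' h => exact ih s' h (h.inv H)
    | retUnsafe => exact Acc.intro _ fun s' h => by cases h
    | retSafe => exact Acc.intro _ fun s' h => by cases h
    | next _ ρ σ h => exact hnext ρ σ H

/-- Induction on the number `k` of bounds still to be passed before `B`. From `B` on, SAFE would
force the counterexample to satisfy `φ`. -/
theorem acc_recStep {B : ℕ} {I : Theory.ModelType.{u, v, max u v} T}
    {x : A.Formals A.main → I} (hx : x ∈ A.boundedSem I B A.main) (hφ : ¬ φ.Realize x) :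
    ∀ (k n : ℕ) (ρ σ : A.AMap), B ≤ n + k → SoundMaps T n ρ σ →
      Unreached T ρ ⟨A.main, ∼φ, n⟩ →
      Acc (fun s' s => RecStep T φ s s') (.bnd n (init φ n ρ σ)) := by
  intro k
  induction k with
  | zero =>
    intro n ρ σ hB H hu
    refine acc_recStep_bnd (acc_bndStep hu) (inv_init H) fun ρ' σ' h => absurd ?_ hφ
    exact models_imp_iff.1 h.2 I x (h.1.subset_overEnv I n _ (boundedSem_mono I hB _ hx))
  | succ k ih =>
    intro n ρ σ hB H hu
    exact acc_recStep_bnd (acc_bndStep hu) (inv_init H) fun ρ' σ' h =>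
      ih (n + 1) _ _ (by omega) h.1.push (h.1.unreached_succ h.2)

theorem terminates_recMC (h : ¬ A.Satisfies T φ) :
    Terminates (RecStep T φ) (recInit φ) RecState.IsUnsafe := by
  classical
  constructor
  · have h' := h
    unfold Satisfies at h'
    push Not at h'
    obtain ⟨I, x, hx, hφ⟩ := h'
    obtain ⟨B, hB⟩ := Set.mem_iUnion.1 (sem_subset_iUnion I _ hx)
    refine not_exists_chain_of_acc (acc_recStep hB hφ B 0 ∅ ∅ (by simp) SoundMaps.empty
      fun I x hx => ?_)
    obtain ⟨_, _, -, h, -⟩ := mem_underEnv.1 hx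
    simp at h
  · intro s hs hstuck
    have H := recInv_of_reachable hs
    cases s with
    | retUnsafe => trivial
    | retSafe => exact absurd H h
    | bnd n s =>
      refine absurd ?_ hstuck
      have hfin : (∃ s', BndStep T φ n s s') ∨ s.IsFinal :=
        or_iff_not_imp_left.2 (isFinal_of_stuck H)
      rcases hfin with ⟨s', hs'⟩ | hfin
      · exact ⟨_, RecStep.inner n s s' hs'⟩
      · cases s with
        | running => exact absurd hfin id
        | resUnsafe ρ σ => exact ⟨_, RecStep.retUnsafe n ρ σ⟩
        | resSafe ρ σ =>
          by_cases hi : IsInductive T σ n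
          · exact ⟨_, RecStep.retSafe n ρ σ hi⟩
          · exact ⟨_, RecStep.next n ρ σ hi⟩

theorem counterexample_of_retUnsafe {ρ : A.AMap}
    (h : Relation.ReflTransGen (RecStep T φ) (recInit φ) (.retUnsafe ρ)) :
    ∃ (δ : L.Formula (A.Formals A.main)) (b : ℕ), (⟨A.main, δ, b⟩ : A.Triple) ∈ ρ ∧
      ∃ (I : Theory.ModelType.{u, v, max u v} T) (x : A.Formals A.main → I),
        δ.Realize x ∧ x ∈ A.boundedSem I b A.main ∧ x ∈ A.sem I A.main ∧ ¬ φ.Realize x := by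
  obtain ⟨n, σ, H, hr⟩ := recInv_of_reachable h
  rw [models_imp_iff] at hr
  push Not at hr
  obtain ⟨I, x, hx, hφ⟩ := hr
  obtain ⟨δ, b, -, hδ, hδx⟩ := mem_underEnv.1 hx
  have hb := H.reachable _ hδ I x hδx
  exact ⟨δ, b, hδ, I, x, hδx, hb, boundedSem_subset_sem I b _ hb, hφ⟩

end Program

end RecMC

/-! ### The main theorem -/

open FirstOrder FirstOrder.Language RecMC RecMC.Program in
theorem theorem2 :
    ∃ K : ℕ, ∀ (L : FirstOrder.Language.{u, v}) (T : L.Theory) (A : Program L)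
      (φ : L.Formula (A.Formals A.main)),
      -- `BndSafety(A, φ, n, ∅, ∅)` terminates, with bounds on the rule applications
      (∀ n : ℕ,
        Terminates (BndStep T φ n) (init φ n ∅ ∅) State.IsFinal ∧
        ∀ (rs : List A.RuleApp) (s : A.State), Run T φ n (init φ n ∅ ∅) rs s →
          (∀ (P : A.Proc) (b : ℕ),
            numReach rs P b ≤ A.maxPaths * (A.numProcs * A.maxPaths + 1) ^ b) ∧
          (∀ q : A.Triple,
            numQuery rs q ≤
              A.maxCalls * A.maxPaths * (A.numProcs * A.maxPaths + 1) ^ q.bound) ∧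
          (∀ q : A.Triple,
            work rs q ≤ K * max q.bound 1 * max A.maxCalls 1 ^ q.bound *
              max (A.numProcs * A.maxPaths) 1 ^ (K * q.bound ^ 2)) ∧
          rs.length ≤ K * max n 1 * max A.maxCalls 1 ^ n *
            max (A.numProcs * A.maxPaths) 1 ^ (K * n ^ 2)) ∧
      -- if there is a counterexample, then every execution of `RecMC` returns `UNSAFE`
      (¬ A.Satisfies T φ → Terminates (RecStep T φ) (recInit φ) RecState.IsUnsafe) ∧
      -- whenever `RecMC` returns `UNSAFE, ρ`, a fact in `ρ` yields an actual counterexample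
      (∀ ρ : A.AMap, Relation.ReflTransGen (RecStep T φ) (recInit φ) (.retUnsafe ρ) →
        ∃ (δ : L.Formula (A.Formals A.main)) (b : ℕ), (⟨A.main, δ, b⟩ : A.Triple) ∈ ρ ∧
          ∃ (I : Theory.ModelType.{u, v, max u v} T) (x : A.Formals A.main → I),
            δ.Realize x ∧ x ∈ A.boundedSem I b A.main ∧ x ∈ A.sem I A.main ∧
              ¬ φ.Realize x) := by
  refine ⟨4, fun L T A φ => ⟨fun n => ⟨terminates_bndSafety n, fun rs s hrun => ?_⟩,
    terminates_recMC, fun ρ => counterexample_of_retUnsafe⟩⟩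
  obtain ⟨rl, ql, Q, ρ, σ, H, -⟩ := hrun.accounting (fresh := True) (fun _ => rfl) (by
    rintro q rfl I x hx
    obtain ⟨_, _, -, h, -⟩ := mem_underEnv.1 hx
    simp at h)
  have hwork := H.fresh_work_le trivial
  refine ⟨fun P b => ?_, fun q => ?_, fun q => (hwork q).trans (by gcongr; omega), ?_⟩
  · exact (H.numReach_le trivial b P).trans (Nat.mul_le_mul_right _ (card_paths_le P))
  · exact (H.numQuery_le q).trans (Nat.mul_le_mul_left _ (H.reachesBelow_le q.bound))
  -- The returning rule is applied to no query; its one extra application raises the factor from 3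
  -- to 4.
  · refine hrun.length_le.trans ((Nat.add_le_add_right (hwork _) 1).trans ?_)
    have hpos : 1 ≤ max n 1 * max A.maxCalls 1 ^ n *
        max (A.numProcs * A.maxPaths) 1 ^ (4 * n ^ 2) := by
      have := le_max_right n 1
      exact Nat.mul_pos (Nat.mul_pos this (pow_pos (le_max_right _ 1) _))
        (pow_pos (le_max_right _ 1) _)
    simp only [mul_assoc] at hpos ⊢
    omega
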